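/- Let $\mathfrak X$ be a countably infinite alphabet and $\mathfrak X^*$ the free monoid over it. A letter is simple (multiple) in a word if it occurs in it exactly once (at least twice). For $\mathbf u,\mathbf v\in\mathfrak X^*$ write $\mathbf u\mathrel{\lambda}\mathbf v$ if (i) $\mathbf u$ and $\mathbf v$ have the same simple letters, (ii) $\mathbf u$ can be obtained from $\mathbf v$ by changing the individual (positive) exponents of letters, and (iii) for each multiple letter, its first two occurrences are adjacent in $\mathbf u$ if and only if they are adjacent in $\mathbf v$. This is a congruence on $\mathfrak X^*$; let $[\mathbf w]^\lambda$ denote the $\lambda$-class of $\mathbf w$. For a $\lambda$-class $\mathtt w$, let $M_\lambda(\mathtt w)$ be the Rees quotient of the monoid $\mathfrak X^*/\lambda$ over the ideal of all $\lambda$-classes $\mathtt v$ that are not factors of $\mathtt w$ (that is, $\mathtt w\ne\mathtt p\mathtt v\mathtt s$ for all $\mathtt p,\mathtt s\in\mathfrak X^*/\lambda$), and let $\mathbf M_\lambda(\mathtt w)$ be the variety of monoids generated by $M_\lambda(\mathtt w)$. For an integer $k\ge 1$ and a permutation $\pi$ of $\{1,\dots,k\}$, put $$\hat{\mathbf a}_{0,k}[\pi]:=x\,z_{\pi(1)}z_{\pi(2)}\cdots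 z_{\pi(k)}\,x\,t_1z_1t_2z_2\cdots t_kz_k,$$ where $x,z_1,\dots,z_k,t_1,\dots,t_k$ are distinct letters. **Proposition.** For every integer $k\ge 1$ and every $\pi\in S_k$, the lattice of subvarieties of the monoid variety $\mathbf M_\lambda([\hat{\mathbf a}_{0,k}[\pi]]^\lambda)$ is not distributive. -/

import Mathlib

/-! ### Varieties of monoids and their lattice -/

/-- A variety of monoids: a class of monoids closed under homomorphic images, submonoids and
direct products of arbitrary families. -/
structure MonoidVariety where
  /-- The class of monoids. -/
  Mem : (M : Type) → [Monoid M] → Prop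
  hom_image : ∀ {M N : Type} [Monoid M] [Monoid N] (f : M →* N),
    Function.Surjective f → Mem M → Mem N
  submonoid : ∀ {M : Type} [Monoid M] (S : Submonoid M), Mem M → Mem S
  product : ∀ {ι : Type} (M : ι → Type) [∀ i, Monoid (M i)],
    (∀ i, Mem (M i)) → Mem (∀ i, M i)

namespace MonoidVariety

/-- Varieties are ordered by inclusion. -/
instance : PartialOrder MonoidVariety where
  le V W := ∀ (M : Type) [Monoid M], V.Mem M → W.Mem M
  le_refl _ _ _ h := h
  le_trans _ _ _ h₁ h₂ M _ h := h₂ M (h₁ M h)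
  le_antisymm V W h₁ h₂ := by
    have h : @V.Mem = @W.Mem := by
      funext M inst
      exact propext ⟨h₁ M, h₂ M⟩
    cases V
    cases W
    cases h
    rfl

/-- The intersection of a family of varieties. -/
instance : InfSet MonoidVariety where
  sInf S :=
    { Mem := fun M _ => ∀ V ∈ S, V.Mem M
      hom_image := fun f hf h V hV => V.hom_image f hf (h V hV)
      submonoid := fun T h V hV => V.submonoid T (h V hV)
      product := fun M _ h V hV => V.product M fun i => h i V hV }

/-- The lattice of all monoid varieties: the meet is the intersection, the join is the least
variety containing both. -/
instance : CompleteLattice MonoidVariety :=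
  completeLatticeOfInf MonoidVariety fun _ =>
    ⟨fun V hV _ _ h => h V hV, fun _ hW M _ h V hV => hW hV M h⟩

/-- The variety generated by the monoid `M`. -/
def generatedBy (M : Type) [Monoid M] : MonoidVariety :=
  sInf {V | V.Mem M}

/-- The lattice of subvarieties of `V`. -/
abbrev SubvarietyLattice (V : MonoidVariety) : Type 1 := Set.Iic V

end MonoidVariety

/-- The lattice `L` is distributive. -/
def IsDistributive (L : Type*) [Lattice L] : Prop :=
  ∀ a b c : L, (a ⊔ b) ⊓ c = (a ⊓ c) ⊔ (b ⊓ c)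

/-! ### Rees quotients and the monoids `M_α(W)` -/

/-- The Rees congruence of a two-sided ideal `I` of a monoid, which identifies all elements
of `I` with one another and nothing else. -/
def reesCon {S : Type*} [Monoid S] (I : Set S)
    (hI : ∀ a ∈ I, ∀ p s : S, p * a * s ∈ I) : Con S where
  r a b := a = b ∨ (a ∈ I ∧ b ∈ I)
  iseqv :=
    { refl := fun _ => Or.inl rfl
      symm := by
        rintro a b (h | ⟨h₁, h₂⟩)
        · exact Or.inl h.symm
        · exact Or.inr ⟨h₂, h₁⟩
      trans := by
        rintro a b c (rfl | ⟨h₁, h₂⟩) (rfl | ⟨h₃, h₄⟩)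
        · exact Or.inl rfl
        · exact Or.inr ⟨h₃, h₄⟩
        · exact Or.inr ⟨h₁, h₂⟩
        · exact Or.inr ⟨h₁, h₄⟩ }
  mul' := by
    have hl : ∀ p a, a ∈ I → p * a ∈ I := fun p a ha => by simpa using hI a ha p 1
    have hr : ∀ a s, a ∈ I → a * s ∈ I := fun a s ha => by simpa using hI a ha 1 s
    rintro a b c d (rfl | ⟨h₁, h₂⟩) (rfl | ⟨h₃, h₄⟩)
    · exact Or.inl rfl
    · exact Or.inr ⟨hl _ _ h₃, hl _ _ h₄⟩
    · exact Or.inr ⟨hr _ _ h₁, hr _ _ h₂⟩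
    · exact Or.inr ⟨hl _ _ h₃, hl _ _ h₄⟩

/-- The set of all factors of elements of `W`. -/
def factorClosure {S : Type*} [Monoid S] (W : Set S) : Set S :=
  {v | ∃ u ∈ W, ∃ p s : S, u = p * v * s}

theorem compl_factorClosure_ideal {S : Type*} [Monoid S] (W : Set S) :
    ∀ a ∈ (factorClosure W)ᶜ, ∀ p s : S, p * a * s ∈ (factorClosure W)ᶜ := by
  rintro a ha p s ⟨u, hu, p', s', rfl⟩
  exact ha ⟨_, hu, p' * p, s * s', by simp only [mul_assoc]⟩

/-- The monoid `M_α(W)`: the Rees quotient of `A* / α` over the ideal of all `α`-classes that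
are not factors of any class in `W`. -/
abbrev QuotMonoid {A : Type} (α : Con (FreeMonoid A)) (W : Set α.Quotient) : Type :=
  (reesCon (factorClosure W)ᶜ (compl_factorClosure_ideal W)).Quotient

/-! ### The congruence `λ` -/

section Lambda

variable {A : Type} [DecidableEq A]

/-- The word obtained from `w` by replacing every maximal block `a ⋯ a` of equal adjacent letters
by the single letter `a`. Two words can be obtained from each other by changing the individual
(positive) exponents of letters if and only if they have the same reduction. -/
def reduceExponents (w : List A) : List A := w.destutter (· ≠ ·)

/-- The letter `a` occurs at least twice in `w`, and its first two occurrences are adjacent. -/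
def FirstTwoAdjacent (a : A) (w : List A) : Prop :=
  ∃ p s : List A, a ∉ p ∧ w = p ++ a :: a :: s

/-- The relation `λ`: the two words have the same simple letters (those that occur exactly once),
they can be obtained from each other by changing the individual exponents of letters, and the
first two occurrences of each multiple letter are adjacent in `u` if and only if they are in `v`. -/
def LambdaRel (u v : List A) : Prop :=
  (∀ a, u.count a = 1 ↔ v.count a = 1) ∧ reduceExponents u = reduceExponents v ∧
    ∀ a, FirstTwoAdjacent a u ↔ FirstTwoAdjacent a v

theorem reduceExponents_head? (l : List A) : (reduceExponents l).head? = l.head? := by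
  have key : ∀ (l : List A) (a : A), (l.destutter' (· ≠ ·) a).head? = some a := by
    intro l
    induction l with
    | nil => intro a; simp
    | cons b l ih =>
      intro a
      by_cases h : a = b
      · subst h
        simpa [List.destutter'_cons] using ih a
      · simp [List.destutter'_cons, h]
  cases l with
  | nil => simp [reduceExponents]
  | cons a l => simpa [reduceExponents, List.destutter_cons'] using key l a

theorem reduceExponents_cons (a : A) (l : List A) :
    reduceExponents (a :: l) =
      if (reduceExponents l).head? = some a then reduceExponents l
      else a :: reduceExponents l := by
  rw [reduceExponents_head?]
  cases l with
  | nil => simp [reduceExponents]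
  | cons b l =>
    by_cases h : a = b
    · subst h
      simp [reduceExponents, List.destutter_cons', List.destutter'_cons]
    · have h' : ¬ b = a := fun e => h e.symm
      simp [reduceExponents, List.destutter_cons', List.destutter'_cons, h, h']

theorem reduceExponents_getLast? (l : List A) :
    (reduceExponents l).getLast? = l.getLast? := by
  induction l with
  | nil => simp [reduceExponents]
  | cons a l ih =>
    rw [reduceExponents_cons, List.getLast?_cons, ← ih]
    split_ifs with h
    · cases hd : (reduceExponents l) with
      | nil => simp [hd] at h
      | cons b m => simp [List.getLast?_cons]
    · rw [List.getLast?_cons]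

theorem mem_reduceExponents (a : A) (l : List A) : a ∈ reduceExponents l ↔ a ∈ l := by
  induction l with
  | nil => simp [reduceExponents]
  | cons b l ih =>
    rw [reduceExponents_cons]
    split_ifs with h
    · have hb : b ∈ l := ih' b l h
      rw [ih, List.mem_cons]
      constructor
      · exact Or.inr
      · rintro (rfl | h')
        · exact hb
        · exact h'
    · simp [ih]
where
  ih' (b : A) (l : List A) (h : (reduceExponents l).head? = some b) : b ∈ l := by
    rw [reduceExponents_head?] at h
    exact List.mem_of_mem_head? h

theorem reduceExponents_append_left (u w : List A) :
    reduceExponents (u ++ w) = reduceExponents (u ++ reduceExponents w) := by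
  induction u with
  | nil => simp [reduceExponents, List.destutter_idem]
  | cons a u ih => rw [List.cons_append, List.cons_append, reduceExponents_cons, ih,
      ← reduceExponents_cons]

theorem reduceExponents_append_right (u w : List A) :
    reduceExponents (u ++ w) = reduceExponents (reduceExponents u ++ w) := by
  induction u with
  | nil => simp [reduceExponents]
  | cons a u ih =>
    rw [List.cons_append, reduceExponents_cons, ih, reduceExponents_cons a u]
    split_ifs with h₁ h₂ h₂
    · rfl
    · rw [List.cons_append, reduceExponents_cons, if_pos h₁]
    · refine absurd ?_ h₁
      rw [reduceExponents_head?]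
      cases hd : reduceExponents u with
      | nil => simp [hd] at h₂
      | cons b m => simpa [hd] using h₂
    · rw [List.cons_append, reduceExponents_cons, if_neg h₁]

theorem firstTwoAdjacent_append (a : A) (u w : List A) :
    FirstTwoAdjacent a (u ++ w) ↔
      FirstTwoAdjacent a u ∨ (a ∉ u ∧ FirstTwoAdjacent a w) ∨
        (u.count a = 1 ∧ u.getLast? = some a ∧ w.head? = some a) := by
  constructor
  · rintro ⟨p, s, hp, h⟩
    rcases List.append_eq_append_iff.1 h with ⟨q, rfl, rfl⟩ | ⟨q, rfl, hq⟩
    · exact Or.inr (Or.inl ⟨fun h' => hp (by simp [h']), q, s, fun h' => hp (by simp [h']), rfl⟩)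
    · rcases q with _ | ⟨b, _ | ⟨c, q⟩⟩
      · refine Or.inr (Or.inl ⟨by simpa using hp, [], s, by simp, ?_⟩)
        simpa using hq.symm
      · simp only [List.cons_append, List.nil_append, List.cons.injEq] at hq
        obtain ⟨rfl, rfl⟩ := hq
        exact Or.inr (Or.inr ⟨by simp [List.count_eq_zero_of_not_mem hp], by simp, by simp⟩)
      · simp only [List.cons_append, List.cons.injEq] at hq
        obtain ⟨rfl, rfl, rfl⟩ := hq
        exact Or.inl ⟨p, q, hp, rfl⟩
  · rintro (⟨p, s, hp, rfl⟩ | ⟨hu, p, s, hp, rfl⟩ | ⟨hc, hl, hh⟩)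
    · exact ⟨p, s ++ w, hp, by simp⟩
    · exact ⟨u ++ p, s, by simp [hu, hp], by simp⟩
    · obtain ⟨p, rfl⟩ := List.getLast?_eq_some_iff.1 hl
      obtain ⟨s, rfl⟩ := List.head?_eq_some_iff.1 hh
      refine ⟨p, s, ?_, by simp⟩
      simpa [List.count_eq_zero] using hc

theorem LambdaRel.mem_iff {u v : List A} (h : LambdaRel u v) (a : A) : a ∈ u ↔ a ∈ v := by
  rw [← mem_reduceExponents, h.2.1, mem_reduceExponents]

theorem LambdaRel.append {u v u' v' : List A} (h : LambdaRel u v) (h' : LambdaRel u' v') :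
    LambdaRel (u ++ u') (v ++ v') := by
  have hz : ∀ {u v : List A}, LambdaRel u v → ∀ a, u.count a = 0 ↔ v.count a = 0 :=
    fun h a => by rw [List.count_eq_zero, List.count_eq_zero, h.mem_iff]
  refine ⟨fun a => ?_, ?_, fun a => ?_⟩
  · have h₁ := h.1 a
    have h₂ := h'.1 a
    have h₃ := hz h a
    have h₄ := hz h' a
    rw [List.count_append, List.count_append]
    omega
  · rw [reduceExponents_append_left, reduceExponents_append_right, h.2.1, h'.2.1,
      ← reduceExponents_append_right, ← reduceExponents_append_left]
  · rw [firstTwoAdjacent_append, firstTwoAdjacent_append, h.1, h.2.2, h'.2.2, h.mem_iff,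
      ← reduceExponents_getLast? u, ← reduceExponents_head? u', h.2.1, h'.2.1,
      reduceExponents_getLast? v, reduceExponents_head? v']

/-- The congruence `λ` on the free monoid. -/
def lambdaCon (A : Type) [DecidableEq A] : Con (FreeMonoid A) where
  r u v := LambdaRel u.toList v.toList
  iseqv :=
    { refl := fun _ => ⟨fun _ => Iff.rfl, rfl, fun _ => Iff.rfl⟩
      symm := fun h => ⟨fun a => (h.1 a).symm, h.2.1.symm, fun a => (h.2.2 a).symm⟩
      trans := fun h h' => ⟨fun a => (h.1 a).trans (h'.1 a), h.2.1.trans h'.2.1,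
        fun a => (h.2.2 a).trans (h'.2.2 a)⟩ }
  mul' h h' := by
    simpa only [FreeMonoid.toList_mul] using h.append h'

end Lambda

/-! ### The words `â_{0,k}[π]` -/

/-- A countably infinite alphabet. -/
inductive Letter : Type
  | x : Letter
  | z (i : ℕ) : Letter
  | t (i : ℕ) : Letter
  deriving DecidableEq

/-- The word `x z_{π(1)} ⋯ z_{π(k)} x t_1 z_1 ⋯ t_k z_k` (with indices shifted to start at `0`). -/
def hatA (k : ℕ) (π : Equiv.Perm (Fin k)) : FreeMonoid Letter :=
  FreeMonoid.of Letter.x *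
    (List.ofFn fun i : Fin k => FreeMonoid.of (Letter.z (π i))).prod *
  FreeMonoid.of Letter.x *
    (List.ofFn fun i : Fin k => FreeMonoid.of (Letter.t i) * FreeMonoid.of (Letter.z i)).prod

/-! ### Invariants of `λ`-equivalent words -/

section LambdaInvariants

variable {A : Type} [DecidableEq A]

/-! Let `V` be the generated variety. The words `mm`, `lm`, `ml` agree except at the end of a block,
which reads z_d x z_c z_e y, x z_d z_c z_e y and z_d x z_c y z_e respectively. Let `A`, `B`, `C` be
the subvarieties of `V` defined by mm ≈ lm, mm ≈ ml and lm ≈ ml. Any two of these identities imply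
the third, so (A ∧ C) ∨ (B ∧ C) satisfies mm ≈ lm. It suffices to find a monoid in (A ∨ B) ∧ C that
violates mm ≈ lm.

This monoid is the syntactic monoid of the intersection of two languages, both made of words "block,
then tail". `YCond` asks for exactly one y before z_e; `XCond` asks for exactly one x before z_d and
at least two before z_c. The word mm satisfies both, lm only the first and ml only the second. The
syntactic monoid for `YCond` lies in `A` and the one for `XCond` in `B`, so the one for the
intersection lies in A ∨ B. It lies in `C` because the intersection is invariant under lm ≈ ml,
although neither language is.

Invariance under identities (`blockLang_yCond`, `blockLang_xCond`, `blockLang_and`): a substitution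
instance of one of the words inside a word of the language has its block part either inside a power
of one letter, where order is irrelevant, or inside the block, where the substitution is very rigid
(`IsBlockSubst`). Counting the letters z then excludes every swap that could alter the defining
condition.

Membership in `V` (`Indist.blockLang_yCond`, `Indist.blockLang_xCond`): the languages must be unions
of classes of the congruence of identities of `V`. Substitutions into factors of the class of â
reconstruct the tail, the order of the z's and the order of first occurrences. The decisive test is
that `λ` preserves the property that exactly one x precedes the first occurrence of the last z
between the two x's (`LambdaRel.count_takeWhile_eq_one`). The letters z_d, z_c, z_e are three copies
of that last z. -/

theorem LambdaRel.rfl {u : List A} : LambdaRel u u := ⟨fun _ => Iff.rfl, by rfl, fun _ => Iff.rfl⟩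

theorem LambdaRel.symm {u v : List A} (h : LambdaRel u v) : LambdaRel v u :=
  ⟨fun a => (h.1 a).symm, h.2.1.symm, fun a => (h.2.2 a).symm⟩

theorem LambdaRel.trans {u v w : List A} (h : LambdaRel u v) (h' : LambdaRel v w) :
    LambdaRel u w :=
  ⟨fun a => (h.1 a).trans (h'.1 a), h.2.1.trans h'.2.1, fun a => (h.2.2 a).trans (h'.2.2 a)⟩

theorem LambdaRel.head?_eq {u v : List A} (h : LambdaRel u v) : u.head? = v.head? := by
  rw [← reduceExponents_head? u, h.2.1, reduceExponents_head?]

theorem LambdaRel.getLast?_eq {u v : List A} (h : LambdaRel u v) : u.getLast? = v.getLast? := by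
  rw [← reduceExponents_getLast? u, h.2.1, reduceExponents_getLast?]

theorem FirstTwoAdjacent.two_le_count {a : A} {l : List A} (h : FirstTwoAdjacent a l) :
    2 ≤ l.count a := by
  obtain ⟨p, s, -, rfl⟩ := h
  simp
  omega

theorem firstTwoAdjacent_dup (b a : A) (l : List A) (hb : b ≠ a) :
    FirstTwoAdjacent b (a :: a :: l) ↔ FirstTwoAdjacent b (a :: l) := by
  have h : ∀ l, FirstTwoAdjacent b (a :: l) ↔ FirstTwoAdjacent b l := by
    intro l
    have := firstTwoAdjacent_append b [a] l
    rw [List.singleton_append] at this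
    rw [this]
    constructor
    · rintro (h | h | h)
      · have := h.two_le_count
        simp [hb.symm] at this
      · exact h.2
      · simp [hb.symm] at h
    · exact fun h => Or.inr (Or.inl ⟨by simpa using hb, h⟩)
  rw [h]

/-- Doubling an occurrence that is not the first one creates no new multiple letter and does not
affect the adjacency of the first two occurrences. -/
theorem lambdaRel_dup {a : A} {l₁ : List A} (ha : a ∈ l₁) (l₂ : List A) :
    LambdaRel (l₁ ++ a :: a :: l₂) (l₁ ++ a :: l₂) := by
  have hc : 1 ≤ l₁.count a := List.one_le_count_iff.2 ha
  refine ⟨fun b => ?_, ?_, fun b => ?_⟩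
  · by_cases hb : b = a
    · subst hb; simp; omega
    · simp [Ne.symm hb]
  · rw [reduceExponents_append_left, reduceExponents_append_left l₁ (a :: l₂)]
    congr 2
    rw [reduceExponents_cons, if_pos]
    rw [reduceExponents_head?, List.head?_cons]
  · rw [firstTwoAdjacent_append, firstTwoAdjacent_append]
    by_cases hb : b = a
    · subst hb; simp [ha]
    · rw [firstTwoAdjacent_dup b a l₂ hb]; simp

theorem lambdaRel_replicate {a : A} {l₁ : List A} (ha : a ∈ l₁) (n : ℕ) (l₂ : List A) :
    LambdaRel (l₁ ++ (List.replicate (n + 1) a ++ l₂)) (l₁ ++ a :: l₂) := by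
  induction n with
  | zero => exact LambdaRel.rfl
  | succ n ih =>
    refine LambdaRel.trans ?_ ih
    simpa [List.replicate_succ] using lambdaRel_dup ha (List.replicate n a ++ l₂)

theorem count_reduceExponents_le (a : A) (l : List A) :
    (reduceExponents l).count a ≤ l.count a := by
  induction l with
  | nil => simp [reduceExponents]
  | cons b l ih =>
    rw [reduceExponents_cons]
    split_ifs <;> simp [List.count_cons] <;> omega

theorem firstTwoAdjacent_of_count_reduceExponents {a : A} {l : List A} (h : 2 ≤ l.count a)
    (hr : (reduceExponents l).count a = 1) : FirstTwoAdjacent a l := by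
  induction l with
  | nil => simp at h
  | cons b l ih =>
    rw [reduceExponents_cons, reduceExponents_head?] at hr
    by_cases hb : b = a
    · subst hb
      split_ifs at hr with hh
      · obtain ⟨s, rfl⟩ := List.head?_eq_some_iff.1 hh
        exact ⟨[], s, by simp, rfl⟩
      · simp only [List.count_cons_self, Nat.add_eq_right, List.count_eq_zero,
          mem_reduceExponents] at hr
        simp [List.count_eq_zero_of_not_mem hr] at h
    · have h' : 2 ≤ l.count a := by simpa [List.count_cons, hb] using h
      have hr' : (reduceExponents l).count a = 1 := by
        split_ifs at hr with hh
        · exact hr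
        · simpa [List.count_cons, hb] using hr
      obtain ⟨p, s, hp, rfl⟩ := ih h' hr'
      exact ⟨b :: p, s, by simp [hp, Ne.symm hb], rfl⟩

theorem reduceExponents_takeWhile (b : A) (l : List A) :
    reduceExponents (l.takeWhile (· ≠ b)) = (reduceExponents l).takeWhile (· ≠ b) := by
  induction l with
  | nil => simp [reduceExponents]
  | cons c l ih =>
    by_cases hc : c = b
    · subst hc
      have hne : ∃ m, reduceExponents (c :: l) = c :: m := by
        rw [← List.head?_eq_some_iff, reduceExponents_head?]; rfl
      obtain ⟨m, hm⟩ := hne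
      rw [hm]
      simp [reduceExponents]
    · rw [List.takeWhile_cons_of_pos (by simpa using hc), reduceExponents_cons,
        reduceExponents_cons c l, ih]
      have hh : ∀ m : List A, (m.takeWhile (· ≠ b)).head? = some c ↔ m.head? = some c := by
        intro m
        cases m with
        | nil => simp
        | cons d m =>
          by_cases hd : d = b
          · subst hd; simp [Ne.symm hc]
          · simp [hd]
      simp only [hh]
      split_ifs
      · rfl
      · rw [List.takeWhile_cons_of_pos (by simpa using hc)]

/-- The prefixes before the first b have the same reduction, in which a occurs once. If a occurred
more often before b in `v`, these occurrences would form one run, so the first two would be adjacent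
in `v` and hence in `u`. In `u`, however, the only a before b is not followed by another a, since
the prefix ends at b. -/
theorem LambdaRel.count_takeWhile_eq_one {u v : List A} (h : LambdaRel u v) {a b : A}
    (hab : a ≠ b) (hb : b ∈ u) (hu : (u.takeWhile (· ≠ b)).count a = 1) :
    (v.takeWhile (· ≠ b)).count a = 1 := by
  have hred : reduceExponents (v.takeWhile (· ≠ b)) = reduceExponents (u.takeWhile (· ≠ b)) := by
    rw [reduceExponents_takeWhile, reduceExponents_takeWhile, h.2.1]
  have hmem : a ∈ v.takeWhile (· ≠ b) := by
    rw [← mem_reduceExponents, hred, mem_reduceExponents, ← List.one_le_count_iff, hu]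
  have h1 : 1 ≤ (v.takeWhile (· ≠ b)).count a := List.one_le_count_iff.2 hmem
  by_contra hne
  have hr1 : (reduceExponents (v.takeWhile (· ≠ b))).count a = 1 := by
    have h2 := count_reduceExponents_le a (u.takeWhile (· ≠ b))
    rw [← hred, hu] at h2
    have h3 := List.one_le_count_iff.2 ((mem_reduceExponents a _).2 hmem)
    omega
  have hv : FirstTwoAdjacent a (v.takeWhile (· ≠ b)) :=
    firstTwoAdjacent_of_count_reduceExponents (by omega) hr1
  have hv' : FirstTwoAdjacent a v := by
    rw [← List.takeWhile_append_dropWhile (p := fun c => decide (c ≠ b)) (l := v)]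
    exact (firstTwoAdjacent_append _ _ _).2 (Or.inl hv)
  have hu' := (h.2.2 a).2 hv'
  have hdrop : (u.dropWhile (· ≠ b)).head? = some b := by
    have := List.head?_dropWhile_not (fun c => decide (c ≠ b)) u
    cases hd : u.dropWhile (· ≠ b) with
    | nil =>
      rw [List.dropWhile_eq_nil_iff] at hd
      exact absurd (hd b hb) (by simp)
    | cons c m =>
      rw [hd] at this
      simpa using this
  rw [← List.takeWhile_append_dropWhile (p := fun c => decide (c ≠ b)) (l := u),
    firstTwoAdjacent_append] at hu'
  rcases hu' with h' | h' | h'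
  · have := h'.two_le_count
    omega
  · exact h'.1 (List.count_pos_iff.1 (by omega))
  · rw [hdrop] at h'
    exact hab (Option.some.inj h'.2.2).symm

end LambdaInvariants

/-! ### Varieties defined by identities and membership of syntactic monoids -/

namespace MonoidVariety

theorem mem_generatedBy (M : Type) [Monoid M] : (generatedBy M).Mem M := fun _ hV => hV

theorem generatedBy_le {M : Type} [Monoid M] {V : MonoidVariety} (h : V.Mem M) :
    generatedBy M ≤ V := fun _ _ hN => hN V h

theorem mem_inf {V W : MonoidVariety} {M : Type} [Monoid M] (hV : V.Mem M) (hW : W.Mem M) :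
    (V ⊓ W).Mem M :=
  (le_inf (generatedBy_le hV) (generatedBy_le hW) : generatedBy M ≤ V ⊓ W) M (mem_generatedBy M)

/-- The variety of all monoids satisfying the identity `u ≈ v`. -/
def ofIdentity {Y : Type} (u v : FreeMonoid Y) : MonoidVariety where
  Mem M _ := ∀ f : FreeMonoid Y →* M, f u = f v
  hom_image := by
    intro M N _ _ f hf h g
    have key : ∃ g' : FreeMonoid Y →* M, f.comp g' = g := by
      refine ⟨FreeMonoid.lift fun y => (hf (g (FreeMonoid.of y))).choose, ?_⟩
      refine FreeMonoid.hom_eq fun y => ?_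
      simpa using (hf (g (FreeMonoid.of y))).choose_spec
    obtain ⟨g', rfl⟩ := key
    simp [h g']
  submonoid := by
    intro M _ S h f
    exact Subtype.ext (h (S.subtype.comp f))
  product := by
    intro ι M _ h f
    funext i
    exact h i ((Pi.evalMonoidHom M i).comp f)

/-- A quotient of a free monoid belongs to every variety that contains enough monoids to
separate its elements. -/
theorem mem_quotient {Y ι : Type} (V : MonoidVariety) (M : ι → Type) [∀ i, Monoid (M i)]
    (hM : ∀ i, V.Mem (M i)) (f : ∀ i, FreeMonoid Y →* M i) (c : Con (FreeMonoid Y))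
    (hc : ∀ u v, (∀ i, f i u = f i v) → c u v) : V.Mem c.Quotient := by
  let F : FreeMonoid Y →* ∀ i, M i := MonoidHom.pi f
  have h₁ : V.Mem (MonoidHom.mrange F) := V.submonoid _ (V.product M hM)
  have hle : Con.ker F ≤ c := fun u v h => hc u v fun i => congrFun (Con.ker_rel _ |>.1 h) i
  let g := (Con.map (Con.ker F) c hle).comp (Con.quotientKerEquivRange F).symm.toMonoidHom
  refine V.hom_image g ?_ h₁
  intro q
  induction q using Con.induction_on with
  | H u => exact ⟨Con.quotientKerEquivRange F (u : (Con.ker F).Quotient), by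
      simp only [g, MonoidHom.comp_apply]
      erw [MulEquiv.symm_apply_apply]
      rfl⟩

end MonoidVariety

/-- The syntactic congruence of a language. -/
def syntacticCon {Y : Type} (L : List Y → Prop) : Con (FreeMonoid Y) where
  r u v := ∀ p s : List Y, L (p ++ u.toList ++ s) ↔ L (p ++ v.toList ++ s)
  iseqv :=
    { refl := fun _ _ _ => Iff.rfl
      symm := fun h p s => (h p s).symm
      trans := fun h h' p s => (h p s).trans (h' p s) }
  mul' := by
    intro a b c d h h' p s
    have h₁ := h p (c.toList ++ s)
    have h₂ := h' (p ++ b.toList) s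
    simp only [FreeMonoid.toList_mul, List.append_assoc] at *
    exact h₁.trans h₂

/-- Every homomorphism from the free monoid to the syntactic monoid lifts to a substitution, so
invariance of `L` under substitution instances in context is enough. -/
theorem syntacticCon_mem_ofIdentity {Y : Type} {L : List Y → Prop} {u v : FreeMonoid Y}
    (h : ∀ (φ : Y → List Y) (p s : List Y),
      L (p ++ u.toList.flatMap φ ++ s) ↔ L (p ++ v.toList.flatMap φ ++ s)) :
    (MonoidVariety.ofIdentity u v).Mem (syntacticCon L).Quotient := by
  intro f
  have hlift : ∃ φ : Y → List Y, ∀ w : FreeMonoid Y,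
      f w = ((FreeMonoid.ofList (w.toList.flatMap φ) : FreeMonoid Y) :
        (syntacticCon L).Quotient) := by
    choose φ hφ using fun y => Con.mk'_surjective (c := syntacticCon L) (f (FreeMonoid.of y))
    refine ⟨fun y => (φ y).toList, fun w => ?_⟩
    induction w using FreeMonoid.recOn with
    | one => simp
    | of_mul a w ih =>
      rw [map_mul, ih, ← hφ]
      simp [← Con.coe_mul]
  obtain ⟨φ, hφ⟩ := hlift
  rw [hφ, hφ, Con.eq]
  exact h φ

/-! ### Words with two interleaved letters -/

/-- The indices a and b serve to fix the order of the first x and the first y. The indices d, c, e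
are copies of the last letter between the two x's of â, and `p i` are the other letters there. -/
inductive ZIndex : Type
  | a : ZIndex
  | b : ZIndex
  | c : ZIndex
  | d : ZIndex
  | e : ZIndex
  | p (i : ℕ) : ZIndex
  deriving DecidableEq

inductive Var : Type
  | x : Var
  | y : Var
  | z (q : ZIndex) : Var
  | t (q : ZIndex) : Var
  deriving DecidableEq

/-- The indices of the letters `z q` of a word, in the order of their occurrences. -/
def zIndices (l : List Var) : List ZIndex :=
  l.filterMap fun v => match v with
    | .z q => some q
    | _ => none

@[simp] theorem zIndices_nil : zIndices [] = [] := rfl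
@[simp] theorem zIndices_x (l : List Var) : zIndices (.x :: l) = zIndices l := rfl
@[simp] theorem zIndices_y (l : List Var) : zIndices (.y :: l) = zIndices l := rfl
@[simp] theorem zIndices_t (q : ZIndex) (l : List Var) : zIndices (.t q :: l) = zIndices l := rfl
@[simp] theorem zIndices_z (q : ZIndex) (l : List Var) :
    zIndices (.z q :: l) = q :: zIndices l := rfl
@[simp] theorem zIndices_append (l l' : List Var) :
    zIndices (l ++ l') = zIndices l ++ zIndices l' := List.filterMap_append
@[simp] theorem zIndices_map_z (l : List ZIndex) : zIndices (l.map .z) = l := by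
  induction l <;> simp_all

theorem mem_zIndices {q : ZIndex} {l : List Var} : q ∈ zIndices l ↔ Var.z q ∈ l := by
  induction l with
  | nil => simp
  | cons v l ih => cases v <;> simp [ih]

theorem count_zIndices (q : ZIndex) (l : List Var) :
    (zIndices l).count q = l.count (.z q) := by
  induction l with
  | nil => simp
  | cons v l ih => cases v <;> simp [List.count_cons, ih]

theorem zIndices_eq_nil {l : List Var} : zIndices l = [] ↔ ∀ q, Var.z q ∉ l := by
  simp [List.eq_nil_iff_forall_not_mem, mem_zIndices]

/-- The number of occurrences of `s` before the first occurrence of `z q`. -/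
def preCount (s : Var) (q : ZIndex) (l : List Var) : ℕ :=
  (l.takeWhile (· ≠ .z q)).count s

theorem preCount_append_of_mem {q : ZIndex} {l : List Var} (h : .z q ∈ l) (s : Var)
    (l' : List Var) : preCount s q (l ++ l') = preCount s q l := by
  unfold preCount
  rw [List.takeWhile_append, if_neg]
  intro hl
  have := (List.takeWhile_prefix (fun v => decide (v ≠ Var.z q)) (l := l)).eq_of_length hl
  rw [List.takeWhile_eq_self_iff] at this
  simpa using this _ h

theorem preCount_append_of_not_mem {q : ZIndex} {l : List Var} (h : .z q ∉ l) (s : Var)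
    (l' : List Var) : preCount s q (l ++ l') = l.count s + preCount s q l' := by
  unfold preCount
  rw [List.takeWhile_append_of_pos, List.count_append]
  intro v hv
  simpa using fun e : v = .z q => h (e ▸ hv)

@[simp] theorem preCount_cons_self (s : Var) (q : ZIndex) (l : List Var) :
    preCount s q (.z q :: l) = 0 := by simp [preCount]

theorem preCount_cons_of_ne {q : ZIndex} {v : Var} (h : v ≠ .z q) (s : Var) (l : List Var) :
    preCount s q (v :: l) = [v].count s + preCount s q l :=
  preCount_append_of_not_mem (l := [v]) (by simpa using h.symm) s l

theorem preCount_le (s : Var) (q : ZIndex) (l : List Var) : preCount s q l ≤ l.count s :=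
  (List.takeWhile_sublist _).count_le _

theorem preCount_le_append {s : Var} {q : ZIndex} {l : List Var} (l' : List Var)
    (h : .z q ∈ l) : preCount s q (l ++ l') ≤ l.count s := by
  rw [preCount_append_of_mem h]; exact preCount_le _ _ _

theorem count_le_preCount_append {s : Var} {q : ZIndex} {l : List Var} (l' : List Var)
    (h : .z q ∉ l) : l.count s ≤ preCount s q (l ++ l') := by
  rw [preCount_append_of_not_mem h]; omega

/-- The order of the first occurrences of the letters `z q`. -/
def zOrder (P : List ZIndex) : List ZIndex := .a :: .b :: (P ++ [.d, .c, .e])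

/-- The last three fields order the first x, z_a, the first y and z_b in this way. Further
occurrences of x and y are unrestricted; only `YCond` and `XCond` look at them. -/
structure IsBlock (P : List ZIndex) (l : List Var) : Prop where
  not_t : ∀ q, Var.t q ∉ l
  zs : zIndices l = zOrder P
  count_x : 2 ≤ l.count .x
  count_y : 2 ≤ l.count .y
  x_a : 1 ≤ preCount .x .a l
  y_a : preCount .y .a l = 0
  y_b : 1 ≤ preCount .y .b l

def YCond (l : List Var) : Prop := preCount .y .e l = 1

def XCond (l : List Var) : Prop := preCount .x .d l = 1 ∧ 2 ≤ preCount .x .c l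

/-- Two blocks that differ by a permutation not seen by the letters `z q`. -/
structure BlockEquiv (l l' : List Var) : Prop where
  perm : l.Perm l'
  zs : zIndices l = zIndices l'
  preCount : ∀ s q, preCount s q l = preCount s q l'

theorem BlockEquiv.symm {l l' : List Var} (h : BlockEquiv l l') : BlockEquiv l' l :=
  ⟨h.perm.symm, h.zs.symm, fun s q => (h.preCount s q).symm⟩

theorem BlockEquiv.isBlock {P : List ZIndex} {l l' : List Var} (h : BlockEquiv l l')
    (hl : IsBlock P l) : IsBlock P l' where
  not_t q := by rw [← h.perm.mem_iff]; exact hl.not_t q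
  zs := by rw [← h.zs, hl.zs]
  count_x := by rw [← h.perm.count_eq]; exact hl.count_x
  count_y := by rw [← h.perm.count_eq]; exact hl.count_y
  x_a := by rw [← h.preCount]; exact hl.x_a
  y_a := by rw [← h.preCount]; exact hl.y_a
  y_b := by rw [← h.preCount]; exact hl.y_b

theorem BlockEquiv.yCond {l l' : List Var} (h : BlockEquiv l l') : YCond l ↔ YCond l' := by
  unfold YCond; rw [h.preCount]

theorem BlockEquiv.xCond {l l' : List Var} (h : BlockEquiv l l') : XCond l ↔ XCond l' := by
  unfold XCond; rw [h.preCount, h.preCount]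

theorem preCount_swap {q : ZIndex} {h g : List Var} (hh : .z q ∉ h) (hg : .z q ∉ g) (s : Var)
    (l k : List Var) :
    preCount s q (l ++ (h ++ (g ++ k))) = preCount s q (l ++ (g ++ (h ++ k))) := by
  by_cases hl : .z q ∈ l
  · rw [preCount_append_of_mem hl, preCount_append_of_mem hl]
  · simp only [preCount_append_of_not_mem hl, preCount_append_of_not_mem hh,
      preCount_append_of_not_mem hg]
    omega

theorem perm_swap (l h g k : List Var) : (l ++ (h ++ (g ++ k))).Perm (l ++ (g ++ (h ++ k))) := by
  refine List.Perm.append_left _ ?_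
  rw [← List.append_assoc, ← List.append_assoc]
  exact List.Perm.append_right _ List.perm_append_comm

theorem blockEquiv_swap {h g : List Var} (hh : zIndices h = []) (hg : zIndices g = [])
    (l k : List Var) : BlockEquiv (l ++ (h ++ (g ++ k))) (l ++ (g ++ (h ++ k))) where
  perm := perm_swap _ _ _ _
  zs := by simp [hh, hg]
  preCount s q := preCount_swap (zIndices_eq_nil.1 hh q) (zIndices_eq_nil.1 hg q) s l k

theorem not_mem_of_zIndices_eq {P : List ZIndex} (hP : (zOrder P).Nodup) {l k : List Var}
    {m : ZIndex} (h : zIndices (l ++ .z m :: k) = zOrder P) : .z m ∉ l := by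
  rw [← h, zIndices_append, zIndices_z] at hP
  rw [← mem_zIndices]
  intro hm
  exact (List.nodup_append.1 hP).2.2 m hm m (by simp) rfl

section Swap

variable {P : List ZIndex} {m : ZIndex} {l g k : List Var}

theorem preCount_left_swap (hl : .z m ∉ l) (s : Var) :
    preCount s m (l ++ .z m :: (g ++ k)) = l.count s := by
  rw [preCount_append_of_not_mem hl, preCount_cons_self, add_zero]

theorem preCount_right_swap (hl : .z m ∉ l) (hg : zIndices g = []) (s : Var) :
    preCount s m (l ++ (g ++ .z m :: k)) = l.count s + g.count s := by
  rw [preCount_append_of_not_mem hl, preCount_append_of_not_mem (zIndices_eq_nil.1 hg m),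
    preCount_cons_self, add_zero]

theorem preCount_swap_of_ne (hg : zIndices g = []) {q : ZIndex} (hq : q ≠ m) (s : Var) :
    preCount s q (l ++ .z m :: (g ++ k)) = preCount s q (l ++ (g ++ .z m :: k)) :=
  preCount_swap (h := [.z m]) (by simpa using hq) (zIndices_eq_nil.1 hg q) s l k

/-- `IsBlock` only asks whether a count before some z is zero or positive. Since all letters of `g`
occur in `l` already, moving `g` across z_m does not change this. -/
theorem isBlock_swap (hl : .z m ∉ l) (hg : zIndices g = []) (hgl : ∀ v ∈ g, v ∈ l) :
    IsBlock P (l ++ .z m :: (g ++ k)) ↔ IsBlock P (l ++ (g ++ .z m :: k)) := by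
  have hperm : (l ++ .z m :: (g ++ k)).Perm (l ++ (g ++ .z m :: k)) := perm_swap l [.z m] g k
  have hzs : zIndices (l ++ .z m :: (g ++ k)) = zIndices (l ++ (g ++ .z m :: k)) := by simp [hg]
  have hpos : ∀ s q, 1 ≤ preCount s q (l ++ .z m :: (g ++ k)) ↔
      1 ≤ preCount s q (l ++ (g ++ .z m :: k)) := by
    intro s q
    by_cases hq : q = m
    · subst hq
      rw [preCount_left_swap hl, preCount_right_swap hl hg]
      by_cases hs : s ∈ g
      · have := List.one_le_count_iff.2 (hgl s hs)
        omega
      · rw [List.count_eq_zero_of_not_mem hs, add_zero]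
    · rw [preCount_swap_of_ne hg hq]
  constructor <;> rintro ⟨h₁, h₂, h₃, h₄, h₅, h₆, h₇⟩
  · refine ⟨fun q => by rw [← hperm.mem_iff]; exact h₁ q, by rw [← hzs, h₂],
      by rw [← hperm.count_eq]; exact h₃, by rw [← hperm.count_eq]; exact h₄,
      (hpos _ _).1 h₅, ?_, (hpos _ _).1 h₇⟩
    have := hpos .y .a
    omega
  · refine ⟨fun q => by rw [hperm.mem_iff]; exact h₁ q, by rw [hzs, h₂],
      by rw [hperm.count_eq]; exact h₃, by rw [hperm.count_eq]; exact h₄,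
      (hpos _ _).2 h₅, ?_, (hpos _ _).2 h₇⟩
    have := hpos .y .a
    omega

/-- Only the count before z_m can change. The one harmful case is a count of exactly 1 before z_e
that `g` would increase, and `h` excludes it. -/
theorem yCond_swap (hl : .z m ∉ l) (hg : zIndices g = []) (hgl : ∀ v ∈ g, v ∈ l)
    (h : m = .e → l.count .y = 1 → .y ∉ g) :
    YCond (l ++ .z m :: (g ++ k)) ↔ YCond (l ++ (g ++ .z m :: k)) := by
  unfold YCond
  by_cases hq : .e = m
  · subst hq
    rw [preCount_left_swap hl, preCount_right_swap hl hg]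
    by_cases hs : .y ∈ g
    · have h₁ := List.one_le_count_iff.2 (hgl _ hs)
      have h₂ := List.one_le_count_iff.2 hs
      have h₃ : l.count .y ≠ 1 := fun h' => h rfl h' hs
      omega
    · rw [List.count_eq_zero_of_not_mem hs, add_zero]
  · rw [preCount_swap_of_ne hg hq]

theorem xCond_swap (hl : .z m ∉ l) (hg : zIndices g = []) (hgl : ∀ v ∈ g, v ∈ l)
    (h : m = .d ∨ m = .c → l.count .x = 1 → .x ∉ g) :
    XCond (l ++ .z m :: (g ++ k)) ↔ XCond (l ++ (g ++ .z m :: k)) := by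
  unfold XCond
  have key : m = .d ∨ m = .c → (.x ∉ g ∨ 2 ≤ l.count .x) := by
    intro hm
    by_cases hs : .x ∈ g
    · have h₁ := List.one_le_count_iff.2 (hgl _ hs)
      have h₃ : l.count .x ≠ 1 := fun h' => h hm h' hs
      omega
    · exact Or.inl hs
  refine and_congr ?_ ?_
  · by_cases hq : .d = m
    · subst hq
      rw [preCount_left_swap hl, preCount_right_swap hl hg]
      rcases key (Or.inl rfl) with hs | hs
      · rw [List.count_eq_zero_of_not_mem hs, add_zero]
      · omega
    · rw [preCount_swap_of_ne hg hq]
  · by_cases hq : .c = m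
    · subst hq
      rw [preCount_left_swap hl, preCount_right_swap hl hg]
      rcases key (Or.inr rfl) with hs | hs
      · rw [List.count_eq_zero_of_not_mem hs, add_zero]
      · omega
    · rw [preCount_swap_of_ne hg hq]

end Swap

/-! ### Substitutions that map a word into a block -/

/-- What is forced on a substitution that maps the block part of a word into a block while the rest
continues into a word of the language. The field `order` reflects that t_b z_b opens the tail: once
the second image of z_b is in the tail, the second images of all other z's are there too. -/
structure IsBlockSubst (P : List ZIndex) (φ : Var → List Var) : Prop where
  x : zIndices (φ .x) = []
  y : zIndices (φ .y) = []
  z : ∀ q ∈ zOrder P, zIndices (φ (.z q)) = [] ∨ ∃ m, φ (.z q) = [.z m]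
  order : ∀ m, φ (.z .b) = [.z m] → ∀ q ∈ zOrder P, .x ∉ φ (.z q) ∧ .y ∉ φ (.z q)

def IsBlockVar (P : List ZIndex) (v : Var) : Prop := v = .x ∨ v = .y ∨ ∃ q ∈ zOrder P, v = .z q

section Subst

variable {P : List ZIndex} {φ : Var → List Var} (hφ : IsBlockSubst P φ)
include hφ

theorem IsBlockSubst.length_le {w : List Var} (hw : ∀ v ∈ w, IsBlockVar P v) :
    (zIndices (w.flatMap φ)).length ≤ (zIndices w).length := by
  induction w with
  | nil => simp
  | cons v w ih =>
    have ih := ih fun v hv => hw v (List.mem_cons_of_mem _ hv)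
    rcases hw v List.mem_cons_self with rfl | rfl | ⟨q, hq, rfl⟩
    · simpa [hφ.x] using ih
    · simpa [hφ.y] using ih
    · rcases hφ.z q hq with h | ⟨m, h⟩
      · simp [h]; omega
      · simp [h]; omega

/-- The letter s must come from the image of some z_q. That image is then not a single z, so this
position contributes no z and the count drops strictly. -/
theorem IsBlockSubst.length_lt {w : List Var} (hw : ∀ v ∈ w, IsBlockVar P v) {s : Var}
    (hs : s = .x ∨ s = .y) (hx : .x ∈ w → s ∉ φ .x) (hy : .y ∈ w → s ∉ φ .y)
    (h : s ∈ w.flatMap φ) :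
    (zIndices (w.flatMap φ)).length < (zIndices w).length := by
  obtain ⟨v, hv, hsv⟩ := List.mem_flatMap.1 h
  obtain ⟨w₁, w₂, rfl⟩ := List.append_of_mem hv
  have h₁ := hφ.length_le (w := w₁) fun v hv => hw v (by simp [hv])
  have h₂ := hφ.length_le (w := w₂) fun v hv => hw v (by simp [hv])
  have h₃ : (zIndices (φ v)).length < (zIndices [v]).length := by
    rcases hw v hv with rfl | rfl | ⟨q, hq, rfl⟩
    · exact absurd hsv (hx (by simp))
    · exact absurd hsv (hy (by simp))
    · rcases hφ.z q hq with h | ⟨m, h⟩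
      · simp [h]
      · rw [h] at hsv
        rcases hs with rfl | rfl <;> simp at hsv
  have h₄ : zIndices (w₁ ++ v :: w₂) = zIndices w₁ ++ (zIndices [v] ++ zIndices w₂) := by
    rw [← zIndices_append, ← zIndices_append]; simp
  rw [h₄]
  simp only [List.flatMap_append, List.flatMap_cons, zIndices_append, List.length_append]
  omega

end Subst

section Block

variable {P : List ZIndex} {l k : List Var}

theorem IsBlock.a_not_mem (h : IsBlock P (l ++ k)) (hx : .x ∉ l) : .z .a ∉ l := by
  intro ha
  have h₁ := h.x_a
  have h₂ := preCount_le_append (s := .x) k ha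
  rw [List.count_eq_zero_of_not_mem hx] at h₂
  omega

theorem IsBlock.y_not_mem (h : IsBlock P (l ++ k)) (ha : .z .a ∉ l) : .y ∉ l := by
  have h₁ := count_le_preCount_append (s := .y) k ha
  rw [h.y_a] at h₁
  exact List.count_eq_zero.1 (by omega)

theorem IsBlock.zIndices_eq_nil (h : IsBlock P (l ++ k)) (ha : .z .a ∉ l) :
    zIndices l = [] := by
  have h₁ := h.zs
  rw [zIndices_append, zOrder] at h₁
  cases hl : zIndices l with
  | nil => rfl
  | cons q r =>
    rw [hl, List.cons_append, List.cons.injEq] at h₁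
    rw [← mem_zIndices, hl, ← h₁.1] at ha
    simp at ha

theorem IsBlock.length_zIndices_le_one (h : IsBlock P (l ++ k)) (hy : .y ∉ l) :
    (zIndices l).length ≤ 1 := by
  have hb : .z .b ∉ l := by
    intro hb
    have h₁ := h.y_b
    have h₂ := preCount_le_append (s := .y) k hb
    rw [List.count_eq_zero_of_not_mem hy] at h₂
    omega
  have h₁ := h.zs
  rw [zIndices_append, zOrder] at h₁
  rw [← mem_zIndices] at hb
  rcases hl : zIndices l with _ | ⟨q, _ | ⟨q', r⟩⟩
  · simp
  · simp
  · rw [hl] at h₁ hb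
    simp only [List.cons_append, List.cons.injEq] at h₁
    rw [← h₁.2.1] at hb
    simp at hb

/-- The part of a block before `z m` contains exactly the letters that precede it in the
prescribed order. -/
theorem IsBlock.zIndices_prefix (hP : (zOrder P).Nodup) {m : ZIndex} {r₁ r₂ : List ZIndex}
    (h : IsBlock P (l ++ .z m :: k)) (hm : zOrder P = r₁ ++ m :: r₂) :
    zIndices l = r₁ ∧ zIndices k = r₂ := by
  have h₁ := h.zs
  rw [zIndices_append, zIndices_z] at h₁
  have h₂ : m ∉ zIndices l := by
    rw [mem_zIndices]; exact not_mem_of_zIndices_eq hP h.zs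
  have h₃ : m ∉ zIndices k := by
    rw [← h.zs, zIndices_append, zIndices_z] at hP
    exact (List.nodup_cons.1 (List.nodup_append.1 hP).2.1).1
  rw [hm] at h₁
  have := (List.append_cons_inj_of_notMem h₂ h₃).1 h₁
  exact ⟨this.1, this.2.2⟩

end Block

/-! ### Letters that cannot occur in the images of x and y -/

section Obstructions

variable {P : List ZIndex} {φ : Var → List Var} {p k M : List Var}

theorem isBlockVar_of_mem {P : List ZIndex} {v : Var}
    (h : v ∈ Var.z .a :: Var.y :: Var.z .b :: P.map .z) : IsBlockVar P v := by
  simp only [List.mem_cons, List.mem_map] at h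
  rcases h with rfl | rfl | rfl | ⟨q, hq, rfl⟩
  · exact Or.inr (Or.inr ⟨.a, by simp [zOrder], rfl⟩)
  · exact Or.inr (Or.inl rfl)
  · exact Or.inr (Or.inr ⟨.b, by simp [zOrder], rfl⟩)
  · exact Or.inr (Or.inr ⟨q, by simp [zOrder, hq], rfl⟩)

/-- If y occurred in the image of x, then `p` would contain no y and hence at most one z. The rest
supplies at most |P| + 2 letters z, but |P| + 4 of them precede z_e. -/
theorem y_not_mem_subst_x (hP : (zOrder P).Nodup) (hφ : IsBlockSubst P φ)
    (h : IsBlock P ((p ++ (.x :: .z .a :: .y :: .z .b :: P.map .z).flatMap φ) ++ .z .e :: k))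
    (h₁ : (p ++ (.x :: .z .a :: .y :: .z .b :: P.map .z).flatMap φ).count .y = 1) :
    .y ∉ φ .x := by
  intro hy
  have hy' := List.one_le_count_iff.2 hy
  have hzs := (h.zIndices_prefix hP (r₁ := .a :: .b :: (P ++ [.d, .c])) (r₂ := [])
    (by simp [zOrder])).1
  have hR := hφ.length_le (w := .z .a :: .y :: .z .b :: P.map .z) fun _ => isBlockVar_of_mem
  rw [List.flatMap_cons] at hzs h₁ h
  set R := (Var.z .a :: .y :: .z .b :: P.map .z).flatMap φ
  simp only [List.append_assoc] at h
  have hp : .y ∉ p := by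
    rw [← List.count_eq_zero]
    simp only [List.count_append] at h₁
    omega
  have h₂ := h.length_zIndices_le_one hp
  have h₃ := congrArg List.length hzs
  simp [hφ.x] at h₃ hR
  omega

/-- If x occurred in the image of y, no x would precede that image. Hence neither z_a nor any other
z, and so no y, occurs up to its end. The y required before z_b must then come from the image of z_b
or of `M`. If z_b is mapped to a single z, the field `order` forbids this; otherwise a position of
`M` is wasted and too few z's precede z_m. -/
theorem x_not_mem_subst_y (hP : (zOrder P).Nodup) (hφ : IsBlockSubst P φ)
    (hM : ∀ v ∈ M, v = .x ∨ ∃ q ∈ zOrder P, v = .z q) (hl : (zIndices M).length = P.length + 2)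
    {m : ZIndex} (hm : m = .d ∨ m = .c)
    (h : IsBlock P ((p ++ (.x :: .z .a :: .y :: .z .b :: M).flatMap φ) ++ .z m :: k))
    (h₁ : (p ++ (.x :: .z .a :: .y :: .z .b :: M).flatMap φ).count .x = 1) :
    .x ∉ φ .y := by
  intro hx
  have hx' := List.one_le_count_iff.2 hx
  obtain ⟨r, hzs, hlen, hb⟩ : ∃ r,
      zIndices (p ++ (.x :: .z .a :: .y :: .z .b :: M).flatMap φ) = r ∧ P.length + 2 ≤ r.length ∧
        .b ∈ r := by
    rcases hm with rfl | rfl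
    · exact ⟨_, (h.zIndices_prefix hP (r₁ := .a :: .b :: P) (r₂ := [.c, .e])
        (by simp [zOrder])).1, by simp, by simp⟩
    · exact ⟨_, (h.zIndices_prefix hP (r₁ := .a :: .b :: (P ++ [.d])) (r₂ := [.e])
        (by simp [zOrder])).1, by simp, by simp⟩
  rw [← hzs, mem_zIndices] at hb
  have hyl : 1 ≤ (p ++ (.x :: .z .a :: .y :: .z .b :: M).flatMap φ).count .y :=
    h.y_b.trans (preCount_le_append _ hb)
  rw [List.one_le_count_iff] at hyl
  simp only [List.flatMap_cons] at hzs h₁ h hyl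
  set l₀ := p ++ (φ .x ++ φ (.z .a)) with hl₀
  have hx₀ : .x ∉ l₀ := by
    rw [← List.count_eq_zero]
    simp only [hl₀, List.count_append] at h₁ ⊢
    omega
  have e : (p ++ (φ .x ++ (φ (.z .a) ++ (φ .y ++ (φ (.z .b) ++ M.flatMap φ))))) ++ .z m :: k =
      l₀ ++ (φ .y ++ (φ (.z .b) ++ (M.flatMap φ ++ .z m :: k))) := by simp [hl₀]
  rw [e] at h
  have ha₀ := h.a_not_mem hx₀
  have hz₀ := h.zIndices_eq_nil ha₀
  have ha₁ : .z .a ∉ l₀ ++ φ .y := by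
    rw [List.mem_append, not_or]
    exact ⟨ha₀, zIndices_eq_nil.1 hφ.y _⟩
  rw [← List.append_assoc] at h
  have hy₁ := h.y_not_mem ha₁
  have hyx : .y ∉ φ .x := fun h' => hy₁ (by simp [hl₀, h'])
  have hy₂ : .y ∈ φ (.z .b) ∨ .y ∈ M.flatMap φ := by
    simp only [hl₀, List.mem_append] at hyl hy₁
    tauto
  rcases hφ.z .b (by simp [zOrder]) with hb' | ⟨m', hm'⟩
  · have ha₂ : .z .a ∉ (l₀ ++ φ .y) ++ φ (.z .b) := by
      rw [List.mem_append, not_or]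
      exact ⟨ha₁, zIndices_eq_nil.1 hb' _⟩
    rw [← List.append_assoc] at h
    have hy₃ := h.y_not_mem ha₂
    have hyM : .y ∈ M.flatMap φ := hy₂.resolve_left fun h' => hy₃ (by simp [h'])
    have := hφ.length_lt (w := M) (fun v hv => (hM v hv).imp_right Or.inr) (Or.inr rfl)
      (fun _ => hyx) (fun h' => by rcases hM _ h' with h' | ⟨q, -, h'⟩ <;> cases h') hyM
    have h₃ := congrArg List.length hzs
    have hz₀' : zIndices p = [] ∧ zIndices (φ (.z .a)) = [] := by
      simp only [hl₀, zIndices_append, List.append_eq_nil_iff] at hz₀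
      tauto
    simp only [zIndices_append, hz₀', hφ.x, hφ.y, hb', List.nil_append] at h₃
    omega
  · have ho := hφ.order m' hm'
    rcases hy₂ with h' | h'
    · simp [hm'] at h'
    · obtain ⟨v, hv, hyv⟩ := List.mem_flatMap.1 h'
      rcases hM v hv with rfl | ⟨q, hq, rfl⟩
      · exact hyx hyv
      · exact (ho q hq).2 hyv

/-- If x occurred in the image of x, then `p` would contain no z, and all z's before z_m would come
from z_a, z_b and `P`. This is one too few for m = c. For m = d every position is needed, which
forces y into its own image; the second copy of that image still precedes z_e, contradicting
`YCond`. -/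
theorem x_not_mem_subst_x (hP : (zOrder P).Nodup) (hφ : IsBlockSubst P φ) {m : ZIndex}
    (hm : m = .d ∨ m = .c)
    (h : IsBlock P ((p ++ (.x :: .z .a :: .y :: .z .b :: P.map .z).flatMap φ) ++
      .z m :: (φ .x ++ (φ (.z .c) ++ (φ .y ++ k)))))
    (hY : YCond ((p ++ (.x :: .z .a :: .y :: .z .b :: P.map .z).flatMap φ) ++
      .z m :: (φ .x ++ (φ (.z .c) ++ (φ .y ++ k)))))
    (h₁ : (p ++ (.x :: .z .a :: .y :: .z .b :: P.map .z).flatMap φ).count .x = 1) :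
    .x ∉ φ .x := by
  intro hx
  have hx' := List.one_le_count_iff.2 hx
  have hRm : ∀ v ∈ (Var.z .a :: .y :: .z .b :: P.map .z), IsBlockVar P v :=
    fun _ => isBlockVar_of_mem
  have hR := hφ.length_le hRm
  set K := φ .x ++ (φ (.z .c) ++ (φ .y ++ k)) with hK
  have hpre : ∀ {r₁ r₂}, zOrder P = r₁ ++ m :: r₂ → _ := fun hr => h.zIndices_prefix hP hr
  rw [List.flatMap_cons] at hpre h₁ h hY
  set R := (Var.z .a :: .y :: .z .b :: P.map .z).flatMap φ with hRdef
  have hxp : .x ∉ p := by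
    rw [← List.count_eq_zero]
    simp only [List.count_append] at h₁
    omega
  have e : (p ++ (φ .x ++ R)) ++ .z m :: K = p ++ (φ .x ++ (R ++ .z m :: K)) := by simp
  have h' := h
  rw [e] at h'
  have ha := h'.a_not_mem hxp
  have hzp := h'.zIndices_eq_nil ha
  have hy : .y ∉ p ++ φ .x := by
    rw [← List.append_assoc] at h'
    refine h'.y_not_mem ?_
    rw [List.mem_append, not_or]
    exact ⟨ha, zIndices_eq_nil.1 hφ.x _⟩
  have hlR : ∀ {r : List ZIndex}, zIndices (p ++ (φ .x ++ R)) = r → zIndices R = r := by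
    intro r hr
    simpa [hzp, hφ.x] using hr
  rcases hm with rfl | rfl
  · obtain ⟨h₂, h₃⟩ := hpre (r₁ := .a :: .b :: P) (r₂ := [.c, .e]) (by simp [zOrder])
    have h₄ := hlR h₂
    have hb : .z .b ∈ p ++ (φ .x ++ R) := by rw [← mem_zIndices, h₂]; simp
    have hyl : .y ∈ p ++ (φ .x ++ R) :=
      List.one_le_count_iff.1 (h.y_b.trans (preCount_le_append _ hb))
    have hyR : .y ∈ R := by
      simp only [List.mem_append] at hyl hy
      tauto
    have hyy : .y ∈ φ .y := by
      by_contra hyy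
      have := hφ.length_lt hRm (Or.inr rfl) (by simp) (fun _ => hyy) hyR
      rw [← hRdef, h₄] at this
      simp at this
    have he : .z .e ∉ p ++ (φ .x ++ R) := by
      rw [← mem_zIndices, h₂]
      intro h'
      have : zOrder P = (.a :: .b :: P) ++ [.d, .c, .e] := by simp [zOrder]
      rw [this] at hP
      exact (List.nodup_append.1 hP).2.2 _ h' .e (by simp) rfl
    -- The z's after z_d are z_c and then z_e, and the image of x contributes none, so a single z
    -- following it must be z_c.
    have hec : .z .e ∉ φ (.z .c) := by
      intro h'
      rcases hφ.z .c (by simp [zOrder]) with hc | ⟨m', hc⟩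
      · exact zIndices_eq_nil.1 hc _ h'
      · rw [hc, List.mem_singleton] at h'
        cases h'
        rw [hK, hc] at h₃
        simp [hφ.x] at h₃
    unfold YCond at hY
    have e' : (p ++ (φ .x ++ R)) ++ .z .d :: K =
        ((p ++ (φ .x ++ R)) ++ .z .d :: (φ .x ++ (φ (.z .c) ++ φ .y))) ++ k := by
      simp [hK]
    have hen : .z .e ∉ (p ++ (φ .x ++ R)) ++ .z .d :: (φ .x ++ (φ (.z .c) ++ φ .y)) := by
      have h₅ := zIndices_eq_nil.1 hφ.x .e
      have h₆ := zIndices_eq_nil.1 hφ.y .e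
      rw [List.mem_append, not_or]
      refine ⟨he, ?_⟩
      simp [h₅, h₆, hec]
    have h₇ := count_le_preCount_append (s := .y) k hen
    rw [← e', hY] at h₇
    have h₈ := List.one_le_count_iff.2 hyl
    have h₉ := List.one_le_count_iff.2 hyy
    rw [List.count_append] at h₇
    simp at h₇
    simp at h₈
    omega
  · have h₂ := (hpre (r₁ := .a :: .b :: (P ++ [.d])) (r₂ := [.e]) (by simp [zOrder])).1
    have h₄ := congrArg List.length (hlR h₂)
    simp at h₄ hR
    omega

/-- If y occurred in its own image, at most one z would precede the first copy of that image.
Counting then forces z_d and z_c to be mapped to single letters, which are z_d and z_c themselves.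
They are adjacent in the image, so the same number of x's precedes both, contrary to `XCond`. This
is why `XCond` involves two letters. -/
theorem y_not_mem_subst_y (hP : (zOrder P).Nodup) (hφ : IsBlockSubst P φ)
    (h : IsBlock P
      ((p ++ (.x :: .z .a :: .y :: .z .b :: (P.map .z ++ [.x, .z .d, .z .c])).flatMap φ)
      ++ .z .e :: k))
    (hX : XCond ((p ++ (.x :: .z .a :: .y :: .z .b :: (P.map .z ++ [.x, .z .d, .z .c])).flatMap φ)
      ++ .z .e :: k))
    (h₁ : (p ++ (.x :: .z .a :: .y :: .z .b ::
      (P.map .z ++ [.x, .z .d, .z .c])).flatMap φ).count .y = 1) :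
    .y ∉ φ .y := by
  intro hy
  have hy' := List.one_le_count_iff.2 hy
  have hzs := (h.zIndices_prefix hP (r₁ := .a :: .b :: (P ++ [.d, .c])) (r₂ := [])
    (by simp [zOrder])).1
  have hB := hφ.length_le (w := .z .b :: P.map .z) fun v hv =>
    isBlockVar_of_mem (List.mem_cons_of_mem _ (List.mem_cons_of_mem _ hv))
  have e : (.x :: .z .a :: .y :: .z .b :: (P.map .z ++ [.x, .z .d, .z .c])).flatMap φ =
      φ .x ++ (φ (.z .a) ++ (φ .y ++ ((.z .b :: P.map .z).flatMap φ ++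
        (φ .x ++ (φ (.z .d) ++ φ (.z .c)))))) := by simp
  rw [e] at hzs h h₁ hX
  set B := (Var.z .b :: P.map .z).flatMap φ
  have hy₀ : .y ∉ p ++ (φ .x ++ φ (.z .a)) := by
    rw [← List.count_eq_zero]
    simp only [List.count_append] at h₁ ⊢
    omega
  have h₂ : (zIndices (p ++ (φ .x ++ φ (.z .a)))).length ≤ 1 := by
    simp only [List.append_assoc] at h
    rw [← List.append_assoc (φ .x), ← List.append_assoc p] at h
    exact h.length_zIndices_le_one hy₀
  have h₃ := congrArg List.length hzs
  simp [hφ.x, hφ.y] at h₃ hB h₂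
  obtain ⟨m₁, hm₁⟩ : ∃ m, φ (.z .d) = [.z m] := by
    rcases hφ.z .d (by simp [zOrder]) with h' | h'
    · rcases hφ.z .c (by simp [zOrder]) with h'' | ⟨m, h''⟩
      · rw [h', h''] at h₃; simp at h₃; omega
      · rw [h', h''] at h₃; simp at h₃; omega
    · exact h'
  obtain ⟨m₂, hm₂⟩ : ∃ m, φ (.z .c) = [.z m] := by
    rcases hφ.z .c (by simp [zOrder]) with h' | h'
    · rw [h', hm₁] at h₃; simp at h₃; omega
    · exact h'
  rw [hm₁, hm₂] at hzs h hX
  have h₄ : zIndices (p ++ (φ .x ++ (φ (.z .a) ++ (φ .y ++ (B ++ φ .x))))) ++ [m₁, m₂] =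
      (.a :: .b :: P) ++ [.d, .c] := by simpa using hzs
  have h₅ := (List.append_inj' h₄ rfl).2
  simp only [List.cons.injEq, and_true] at h₅
  obtain ⟨rfl, rfl⟩ := h₅
  set K := p ++ (φ .x ++ (φ (.z .a) ++ (φ .y ++ (B ++ φ .x)))) with hK
  have e' : (p ++ (φ .x ++ (φ (.z .a) ++ (φ .y ++ (B ++ (φ .x ++ ([.z .d] ++ [.z .c]))))))) ++
      .z .e :: k = K ++ .z .d :: .z .c :: .z .e :: k := by simp [hK]
  rw [e'] at h hX
  have hd := not_mem_of_zIndices_eq hP h.zs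
  have hc : .z .c ∉ K ++ [.z .d] := by
    refine not_mem_of_zIndices_eq hP (k := .z .e :: k) ?_
    rw [← h.zs]; simp
  have h₆ := hX.1
  have h₇ := hX.2
  rw [preCount_append_of_not_mem hd, preCount_cons_self] at h₆
  have e'' : K ++ .z .d :: .z .c :: .z .e :: k = (K ++ [.z .d]) ++ (.z .c :: .z .e :: k) := by simp
  rw [e'', preCount_append_of_not_mem hc, preCount_cons_self, List.count_append] at h₇
  simp at h₇
  omega

end Obstructions

/-! ### Languages invariant under identities -/

/-- The second halves of the words under consideration. -/
def tailWord (τ : List ZIndex) (f : ZIndex → ℕ) : List Var :=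
  τ.flatMap fun q => .t q :: List.replicate (f q + 1) (.z q)

theorem tailWord_cons (q : ZIndex) (τ : List ZIndex) (f : ZIndex → ℕ) :
    tailWord (q :: τ) f = .t q :: (List.replicate (f q + 1) (.z q) ++ tailWord τ f) := by
  simp [tailWord]

theorem mem_tailWord {v : Var} {τ : List ZIndex} {f : ZIndex → ℕ} :
    v ∈ tailWord τ f ↔ ∃ q ∈ τ, v = .t q ∨ v = .z q := by
  simp [tailWord]

theorem count_t_tailWord_le {τ : List ZIndex} (hτ : τ.Nodup) (f : ZIndex → ℕ) (q : ZIndex) :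
    (tailWord τ f).count (.t q) ≤ 1 := by
  induction τ with
  | nil => simp [tailWord]
  | cons r τ ih =>
    rw [List.nodup_cons] at hτ
    have ih := ih hτ.2
    rw [tailWord_cons, List.count_cons, List.count_append, List.count_replicate]
    by_cases h : r = q
    · subst h
      have : (tailWord τ f).count (.t r) = 0 := by
        rw [List.count_eq_zero, mem_tailWord]
        rintro ⟨q, hq, h | h⟩
        · cases h; exact hτ.1 hq
        · cases h
      simp [this]
    · simpa [h] using ih

theorem exists_tailWord_eq_cons (q : ZIndex) (τ : List ZIndex) (f : ZIndex → ℕ) :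
    ∃ k, tailWord (q :: τ) f = .t q :: k := ⟨_, tailWord_cons q τ f⟩

theorem tailWord_isChain (τ : List ZIndex) (f : ZIndex → ℕ) :
    (tailWord τ f).IsChain fun v w => v = w ∨ (∃ q, v = .t q) ∨ ∃ q, w = .t q := by
  induction τ with
  | nil => simp [tailWord]
  | cons q τ ih =>
    rw [tailWord_cons, List.isChain_cons]
    refine ⟨fun w _ => Or.inr (Or.inl ⟨q, rfl⟩), ?_⟩
    rw [List.isChain_append]
    refine ⟨?_, ih, ?_⟩
    · exact List.isChain_replicate_of_rel _ (Or.inl rfl)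
    · intro v _ w hw
      cases τ with
      | nil => simp [tailWord] at hw
      | cons r τ =>
        rw [tailWord_cons] at hw
        exact Or.inr (Or.inr ⟨r, by simpa using hw.symm⟩)

theorem eq_of_isChain {M : List Var}
    (h : M.IsChain fun v w => v = w ∨ (∃ q, v = .t q) ∨ ∃ q, w = .t q)
    (ht : ∀ q, .t q ∉ M) : ∀ v ∈ M, ∀ w ∈ M, v = w := by
  have key : ∀ (M : List Var) (v : Var),
      ((v :: M).IsChain fun v w => v = w ∨ (∃ q, v = .t q) ∨ ∃ q, w = .t q) →
      (∀ q, .t q ∉ v :: M) → ∀ w ∈ v :: M, w = v := by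
    intro M
    induction M with
    | nil => intro v _ _ w hw; simpa using hw
    | cons u M ih =>
      intro v h ht w hw
      rw [List.isChain_cons_cons] at h
      have huv : v = u := by
        rcases h.1 with h' | ⟨q, rfl⟩ | ⟨q, rfl⟩
        · exact h'
        · exact absurd List.mem_cons_self (ht q)
        · exact absurd (by simp) (ht q)
      subst huv
      rcases List.mem_cons.1 hw with rfl | hw
      · rfl
      · exact ih _ h.2 (fun q hq => ht q (List.mem_cons_of_mem _ hq)) w hw
  intro v hv w hw
  cases M with
  | nil => simp at hv
  | cons u M => rw [key M u h ht v hv, key M u h ht w hw]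

/-- Two distinct adjacent letters of the tail always include a t, so a factor without t is a power
of one letter. -/
theorem eq_of_infix_tailWord {τ : List ZIndex} {f : ZIndex → ℕ} {M : List Var}
    (h : M <:+: tailWord τ f) (ht : ∀ q, .t q ∉ M) : ∀ v ∈ M, ∀ w ∈ M, v = w :=
  eq_of_isChain ((tailWord_isChain τ f).infix h) ht

/-- A factor of `l ++ t q :: k` without letters `t` lies in one of the two parts. -/
theorem append_eq_append_of_not_t {l k p M r : List Var} {q : ZIndex} (ht : ∀ q, .t q ∉ M)
    (h : p ++ (M ++ r) = l ++ .t q :: k) :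
    (∃ h', l = p ++ (M ++ h') ∧ r = h' ++ .t q :: k) ∨
      ∃ c, p = l ++ c ∧ .t q :: k = c ++ (M ++ r) := by
  rcases List.append_eq_append_iff.1 h with ⟨c, rfl, hc⟩ | ⟨c, rfl, hc⟩
  · rcases List.append_eq_append_iff.1 hc with ⟨c', rfl, hc'⟩ | ⟨c', rfl, hc'⟩
    · exact Or.inl ⟨c', rfl, hc'⟩
    · cases c' with
      | nil => exact Or.inl ⟨[], by simp, by simpa using hc'.symm⟩
      | cons v c' =>
        simp only [List.cons_append, List.cons.injEq] at hc'
        exact absurd (by simp [← hc'.1]) (ht q)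
  · exact Or.inr ⟨c, rfl, hc⟩

theorem count_mul_le_count_flatMap (φ : Var → List Var) (v c : Var) (w : List Var) :
    w.count v * (φ v).count c ≤ (w.flatMap φ).count c := by
  induction w with
  | nil => simp
  | cons u w ih =>
    rw [List.flatMap_cons, List.count_append, List.count_cons]
    by_cases h : u = v
    · subst h; simp [Nat.add_mul]; omega
    · simp [h]; omega

/-- The words consisting of a block with the property `C` and a tail. -/
def BlockLang (P τ : List ZIndex) (C : List Var → Prop) (w : List Var) : Prop :=
  ∃ l f, w = l ++ tailWord τ f ∧ IsBlock P l ∧ C l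

theorem IsBlock.count_z_le {P : List ZIndex} (hP : (zOrder P).Nodup) {l : List Var}
    (h : IsBlock P l) (m : ZIndex) : l.count (.z m) ≤ 1 := by
  rw [← count_zIndices, h.zs]
  exact List.nodup_iff_count_le_one.1 hP m

section Step

variable {P τ : List ZIndex} (hP : (zOrder P).Nodup) (hτ : (ZIndex.b :: τ).Nodup)
  (hPτ : ∀ q ∈ zOrder P, q ∈ ZIndex.b :: τ)
include hP hτ hPτ

/-- Every letter of `U` occurs at least twice in the whole word, whereas each t occurs at most once
in a word of the language. So the image of `U` contains no t and lies entirely in the block or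
entirely in the tail. -/
theorem BlockLang.step {C : List Var → Prop} {U U' : List Var}
    (hU : U.Perm (.x :: .x :: .y :: .y :: (zOrder P).map .z)) (hUU' : U.Perm U')
    {φ : Var → List Var}
    (key : IsBlockSubst P φ → ∀ p h', IsBlock P (p ++ (U.flatMap φ ++ h')) ∧
      C (p ++ (U.flatMap φ ++ h')) → IsBlock P (p ++ (U'.flatMap φ ++ h')) ∧
      C (p ++ (U'.flatMap φ ++ h'))) {p r : List Var}
    (h : BlockLang P (.b :: τ) C (p ++ (U ++ tailWord (.b :: τ) 0).flatMap φ ++ r)) :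
    BlockLang P (.b :: τ) C (p ++ (U' ++ tailWord (.b :: τ) 0).flatMap φ ++ r) := by
  obtain ⟨l, f, hw, hl, hC⟩ := h
  rw [List.flatMap_append, List.append_assoc, List.append_assoc] at hw ⊢
  set T := (tailWord (.b :: τ) 0).flatMap φ with hT
  have hcU : ∀ v, U.count v = List.count v (.x :: .x :: .y :: .y :: (zOrder P).map .z) :=
    fun v => hU.count_eq v
  have htwo : ∀ v ∈ U, 2 ≤ (U ++ tailWord (.b :: τ) 0).count v := by
    intro v hv
    rw [List.count_append, hcU]
    have hv' := hU.mem_iff.1 hv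
    simp only [List.mem_cons, List.mem_map] at hv'
    rcases hv' with rfl | rfl | rfl | rfl | ⟨q, hq, rfl⟩
    · simp; omega
    · simp; omega
    · simp; omega
    · simp; omega
    · have h₁ : 0 < (tailWord (.b :: τ) 0).count (Var.z q) :=
        List.count_pos_iff.2 (mem_tailWord.2 ⟨q, hPτ q hq, Or.inr rfl⟩)
      have h₂ : 0 < (List.map Var.z (zOrder P)).count (Var.z q) :=
        List.count_pos_iff.2 (List.mem_map_of_mem hq)
      simp only [List.count_cons]
      omega
  have htφ : ∀ v ∈ U, ∀ q, .t q ∉ φ v := by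
    intro v hv q hq
    have h₁ := count_mul_le_count_flatMap φ v (.t q) (U ++ tailWord (.b :: τ) 0)
    have h₂ : (p ++ (U.flatMap φ ++ (T ++ r))).count (.t q) ≤ 1 := by
      rw [hw, List.count_append, List.count_eq_zero_of_not_mem (hl.not_t q), zero_add]
      exact count_t_tailWord_le hτ f q
    have h₃ := Nat.mul_le_mul (htwo v hv) (List.one_le_count_iff.2 hq)
    rw [List.flatMap_append, ← hT] at h₁
    simp only [List.count_append] at h₁ h₂ h₃
    omega
  have htU : ∀ q, .t q ∉ U.flatMap φ := by
    intro q hq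
    obtain ⟨v, hv, hq⟩ := List.mem_flatMap.1 hq
    exact htφ v hv q hq
  obtain ⟨k, hk⟩ := exists_tailWord_eq_cons .b τ f
  have hw' := hw
  rw [hk] at hw'
  have hperm : (U.flatMap φ).Perm (U'.flatMap φ) := hUU'.flatMap_right φ
  rcases append_eq_append_of_not_t htU hw' with ⟨h', hlp, hr⟩ | ⟨c, hc, hk'⟩
  · have hφ : IsBlockSubst P φ := by
      have hcount := hl.count_z_le hP
      -- Each z occurs only once in a block, so a letter occurring twice in `U` cannot have a z in
      -- its image.
      have hxy : ∀ v, U.count v = 2 → zIndices (φ v) = [] := by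
        intro v hv
        rw [zIndices_eq_nil]
        intro m hm
        have h₁ := count_mul_le_count_flatMap φ v (.z m) U
        have h₂ := Nat.mul_le_mul hv.ge (List.one_le_count_iff.2 hm)
        have h₃ := hcount m
        rw [hlp] at h₃
        simp only [List.count_append] at h₃
        omega
      have hzU : ∀ q ∈ zOrder P, .z q ∈ U := fun q hq =>
        hU.mem_iff.2 (by simpa using hq)
      have hnot : ∀ q ∈ zOrder P, ∀ m, .z m ∈ φ (.z q) → .z m ∉ h' := by
        intro q hq m hm hm'
        have h₁ := hcount m
        have h₂ : 0 < (U.flatMap φ).count (.z m) :=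
          List.count_pos_iff.2 (List.mem_flatMap.2 ⟨_, hzU q hq, hm⟩)
        have h₃ := List.count_pos_iff.2 hm'
        rw [hlp] at h₁
        simp only [List.count_append] at h₁
        omega
      refine ⟨hxy .x ?_, hxy .y ?_, ?_, ?_⟩
      · rw [hcU]
        have : List.count Var.x (List.map Var.z (zOrder P)) = 0 := by simp [List.count_eq_zero]
        simp [this]
      · rw [hcU]
        have : List.count Var.y (List.map Var.z (zOrder P)) = 0 := by simp [List.count_eq_zero]
        simp [this]
      · intro q hq
        rw [or_iff_not_imp_left]
        intro hne
        obtain ⟨m, hm⟩ := List.exists_mem_of_ne_nil _ hne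
        rw [mem_zIndices] at hm
        -- The occurrence of z_q in the tail of the identity is mapped to a second copy of z_m. It
        -- cannot lie in the block, hence it is a factor of the tail without t, that is, a power of
        -- z_m; the single z_m in the block makes the exponent 1.
        obtain ⟨T₁, T₂, hT'⟩ := List.append_of_mem
          ((mem_tailWord (τ := .b :: τ) (f := 0)).2 ⟨q, hPτ q hq, Or.inr rfl⟩)
        have hr' : T₁.flatMap φ ++ (φ (.z q) ++ (T₂.flatMap φ ++ r)) = h' ++ .t .b :: k := by
          rw [← hr, hT, hT']; simp
        rcases append_eq_append_of_not_t (htφ _ (hzU q hq)) hr' with ⟨c, hc, -⟩ | ⟨c, -, hc⟩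
        · exact absurd (by rw [hc]; simp [hm]) (hnot q hq m hm)
        · rw [← hk] at hc
          have hconst := eq_of_infix_tailWord ⟨c, _, by rw [hc, List.append_assoc]⟩
            (htφ _ (hzU q hq))
          have hrep : φ (.z q) = List.replicate (φ (.z q)).length (.z m) :=
            List.eq_replicate_of_mem fun v hv => hconst v hv _ hm
          have hlen : (φ (.z q)).length = 1 := by
            have h₁ := count_mul_le_count_flatMap φ (.z q) (.z m) U
            have h₂ := hcount m
            have h₃ := List.count_pos_iff.2 (hzU q hq)
            have h₄ : (φ (.z q)).count (.z m) = (φ (.z q)).length := by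
              conv_lhs => rw [hrep]
              simp
            have h₅ := List.length_pos_of_mem hm
            rw [hlp] at h₂
            simp only [List.count_append] at h₂
            rw [h₄] at h₁
            nlinarith
          exact ⟨m, by rw [hrep, hlen]; rfl⟩
      · intro m hm q hq
        have hm' := hnot .b (by simp [zOrder]) m (by simp [hm])
        rcases List.mem_cons.1 (hPτ q hq) with rfl | hq'
        · simp [hm]
        · have hr' : φ (.t .b) ++ ([.z m] ++ ((tailWord τ 0).flatMap φ ++ r)) = h' ++ .t .b :: k := by
            rw [← hr, hT, tailWord_cons]
            simp [hm]
          rcases append_eq_append_of_not_t (by simp) hr' with ⟨c, hc, -⟩ | ⟨c, -, hc⟩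
          · exact absurd (by rw [hc]; simp) hm'
          · rw [← hk] at hc
            have hsub : ∀ s ∈ φ (.z q), s ∈ tailWord (.b :: τ) f := by
              intro s hs
              rw [hc]
              have : s ∈ (tailWord τ 0).flatMap φ :=
                List.mem_flatMap.2 ⟨_, mem_tailWord.2 ⟨q, hq', Or.inr rfl⟩, hs⟩
              simp [this]
            constructor
            · intro hs
              simpa [mem_tailWord] using hsub _ hs
            · intro hs
              simpa [mem_tailWord] using hsub _ hs
    have := key hφ p h' (by rw [← hlp]; exact ⟨hl, hC⟩)
    exact ⟨_, f, by rw [hr, ← hk]; simp, this.1, this.2⟩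
  · rw [← hk] at hk'
    have hconst := eq_of_infix_tailWord ⟨c, _, by rw [hk', List.append_assoc]⟩ htU
    -- In the tail the image of `U` is a power of one letter, so permuting it has no effect.
    have heq : U'.flatMap φ = U.flatMap φ := by
      rcases hU₀ : U.flatMap φ with _ | ⟨v, M⟩
      · rw [hU₀] at hperm
        exact hperm.nil_eq.symm
      · have h₁ : ∀ w ∈ U'.flatMap φ, w = v := fun w hw =>
          hconst w (hperm.mem_iff.2 hw) v (by simp [hU₀])
        have h₂ : ∀ w ∈ v :: M, w = v := fun w hw =>
          hconst w (by rwa [hU₀]) v (by simp [hU₀])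
        rw [List.eq_replicate_of_mem h₁, List.eq_replicate_of_mem h₂, ← hU₀, hperm.length_eq]
    rw [heq]
    exact ⟨l, f, hw, hl, hC⟩

end Step

/-- If the image of z_q has no z, the swap is invisible. Otherwise it is a single z_m, and because s
occurs in `G`, only the condition `C` remains to be compared. -/
theorem block_swap_iff {P : List ZIndex} (hP : (zOrder P).Nodup) {C : List Var → Prop}
    (hC : ∀ l l', BlockEquiv l l' → (C l ↔ C l')) {φ : Var → List Var} (hφ : IsBlockSubst P φ)
    {G : List Var} (H : List Var) {s : Var} (hs : s = .x ∨ s = .y) (hsG : s ∈ G) {q : ZIndex}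
    (hq : q ∈ zOrder P) (p h' : List Var)
    (hswap : ∀ m, IsBlock P ((p ++ G.flatMap φ) ++ .z m :: (φ s ++ (H.flatMap φ ++ h'))) →
      .z m ∉ p ++ G.flatMap φ → zIndices (φ s) = [] → (∀ v ∈ φ s, v ∈ p ++ G.flatMap φ) →
      (C ((p ++ G.flatMap φ) ++ .z m :: (φ s ++ (H.flatMap φ ++ h'))) ↔
        C ((p ++ G.flatMap φ) ++ (φ s ++ .z m :: (H.flatMap φ ++ h'))))) :
    (IsBlock P (p ++ ((G ++ .z q :: s :: H).flatMap φ ++ h')) ∧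
        C (p ++ ((G ++ .z q :: s :: H).flatMap φ ++ h'))) ↔
      (IsBlock P (p ++ ((G ++ s :: .z q :: H).flatMap φ ++ h')) ∧
        C (p ++ ((G ++ s :: .z q :: H).flatMap φ ++ h'))) := by
  have hzs : zIndices (φ s) = [] := by
    rcases hs with rfl | rfl
    · exact hφ.x
    · exact hφ.y
  have e₁ : p ++ ((G ++ .z q :: s :: H).flatMap φ ++ h') =
      (p ++ G.flatMap φ) ++ (φ (.z q) ++ (φ s ++ (H.flatMap φ ++ h'))) := by simp
  have e₂ : p ++ ((G ++ s :: .z q :: H).flatMap φ ++ h') =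
      (p ++ G.flatMap φ) ++ (φ s ++ (φ (.z q) ++ (H.flatMap φ ++ h'))) := by simp
  rw [e₁, e₂]
  rcases hφ.z q hq with hz | ⟨m, hm⟩
  · have := blockEquiv_swap hz hzs (p ++ G.flatMap φ) (H.flatMap φ ++ h')
    exact and_congr ⟨this.isBlock, this.symm.isBlock⟩ (hC _ _ this)
  · rw [hm, List.singleton_append, List.singleton_append]
    have hgl : ∀ v ∈ φ s, v ∈ p ++ G.flatMap φ := fun v hv =>
      List.mem_append_right _ (List.mem_flatMap.2 ⟨s, hsG, hv⟩)
    constructor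
    · rintro ⟨h₁, h₂⟩
      have hl := not_mem_of_zIndices_eq hP h₁.zs
      exact ⟨(isBlock_swap hl hzs hgl).1 h₁, (hswap m h₁ hl hzs hgl).1 h₂⟩
    · rintro ⟨h₁, h₂⟩
      have hl : .z m ∉ p ++ G.flatMap φ := by
        have h₃ := h₁.zs
        rw [← List.append_assoc] at h₃
        exact fun h => not_mem_of_zIndices_eq hP h₃ (List.mem_append_left _ h)
      have h₃ := (isBlock_swap hl hzs hgl).2 h₁
      exact ⟨h₃, (hswap m h₃ hl hzs hgl).2 h₂⟩

theorem eq_x_or_z_of_mem {P : List ZIndex} {H : List Var}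
    (hH : ∀ v ∈ H, v = .x ∨ v = .z .d ∨ v = .z .c) :
    ∀ v ∈ P.map .z ++ H, v = .x ∨ ∃ q ∈ zOrder P, v = .z q := by
  intro v hv
  rcases List.mem_append.1 hv with hv | hv
  · obtain ⟨q, hq, rfl⟩ := List.mem_map.1 hv
    exact Or.inr ⟨q, by simp [zOrder, hq], rfl⟩
  · rcases hH v hv with rfl | rfl | rfl
    · exact Or.inl rfl
    · exact Or.inr ⟨_, by simp [zOrder], rfl⟩
    · exact Or.inr ⟨_, by simp [zOrder], rfl⟩

/-- The common beginning of the words under consideration. -/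
def blockHead (P : List ZIndex) : List Var := .x :: .z .a :: .y :: .z .b :: P.map .z

theorem blockHead_append (P : List ZIndex) (H : List Var) :
    blockHead P ++ H = .x :: .z .a :: .y :: .z .b :: (P.map .z ++ H) := rfl

/-- The words under consideration, depending on the end of the block. -/
def interleavedWord (P τ : List ZIndex) (H : List Var) : List Var :=
  (blockHead P ++ H) ++ tailWord (.b :: τ) 0

/-! ### Invariance of the languages under the three identities -/

section Identities

variable {P τ : List ZIndex} (hP : (zOrder P).Nodup) (hτ : (ZIndex.b :: τ).Nodup)
  (hPτ : ∀ q ∈ zOrder P, q ∈ ZIndex.b :: τ)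
include hP hτ hPτ

theorem blockLang_iff {C : List Var → Prop} {H H' : List Var}
    (hH : H.Perm [.z .d, .x, .z .c, .z .e, .y]) (hH' : H'.Perm [.z .d, .x, .z .c, .z .e, .y])
    {φ : Var → List Var}
    (key : IsBlockSubst P φ → ∀ p h',
      (IsBlock P (p ++ ((blockHead P ++ H).flatMap φ ++ h')) ∧
        C (p ++ ((blockHead P ++ H).flatMap φ ++ h'))) ↔
      (IsBlock P (p ++ ((blockHead P ++ H').flatMap φ ++ h')) ∧
        C (p ++ ((blockHead P ++ H').flatMap φ ++ h')))) (p r : List Var) :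
    BlockLang P (.b :: τ) C (p ++ (interleavedWord P τ H).flatMap φ ++ r) ↔
      BlockLang P (.b :: τ) C (p ++ (interleavedWord P τ H').flatMap φ ++ r) := by
  have hperm : ∀ {K : List Var}, K.Perm [.z .d, .x, .z .c, .z .e, .y] →
      (blockHead P ++ K).Perm (.x :: .x :: .y :: .y :: (zOrder P).map .z) := by
    intro K hK
    refine (hK.append_left _).trans ?_
    rw [List.perm_iff_count]
    intro v
    simp [blockHead, zOrder, List.count_cons]
    omega
  have h₁ := hperm hH
  have h₂ := hperm hH'
  exact ⟨BlockLang.step hP hτ hPτ h₁ (h₁.trans h₂.symm) fun hφ p h' => (key hφ p h').1,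
    BlockLang.step hP hτ hPτ h₂ (h₂.trans h₁.symm) fun hφ p h' => (key hφ p h').2⟩

theorem blockLang_yCond (φ : Var → List Var) (p r : List Var) :
    BlockLang P (.b :: τ) YCond
        (p ++ (interleavedWord P τ [.z .d, .x, .z .c, .z .e, .y]).flatMap φ ++ r) ↔
      BlockLang P (.b :: τ) YCond
        (p ++ (interleavedWord P τ [.x, .z .d, .z .c, .z .e, .y]).flatMap φ ++ r) := by
  refine blockLang_iff hP hτ hPτ (List.Perm.refl _) (List.Perm.swap _ _ _) (fun hφ p h' => ?_) p r
  refine block_swap_iff hP (fun _ _ h => h.yCond) hφ _ (Or.inl rfl) (by simp [blockHead])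
    (by simp [zOrder]) p h' ?_
  intro m h₁ hl hzs hgl
  refine yCond_swap hl hzs hgl ?_
  rintro rfl hc
  exact y_not_mem_subst_x hP hφ h₁ hc

theorem blockLang_xCond (φ : Var → List Var) (p r : List Var) :
    BlockLang P (.b :: τ) XCond
        (p ++ (interleavedWord P τ [.z .d, .x, .z .c, .z .e, .y]).flatMap φ ++ r) ↔
      BlockLang P (.b :: τ) XCond
        (p ++ (interleavedWord P τ [.z .d, .x, .z .c, .y, .z .e]).flatMap φ ++ r) := by
  refine blockLang_iff hP hτ hPτ (List.Perm.refl _)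
    (by rw [List.perm_iff_count]; intro v; simp only [List.count_cons]; omega)
    (fun hφ p h' => ?_) p r
  have := block_swap_iff hP (fun _ _ h => h.xCond) hφ (G := blockHead P ++ [.z .d, .x, .z .c])
    [] (Or.inr rfl) (by simp [blockHead]) (q := .e) (by simp [zOrder]) p h' ?_
  · simpa only [List.append_assoc, List.cons_append, List.nil_append] using this
  intro m h₁ hl hzs hgl
  refine xCond_swap hl hzs hgl ?_
  intro hm hc
  rw [blockHead_append] at h₁ hc
  have hM := eq_x_or_z_of_mem (P := P) (H := [Var.z .d, Var.x, Var.z .c]) (by simp)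
  exact x_not_mem_subst_y hP hφ hM (by simp) hm h₁ hc

theorem blockLang_and (φ : Var → List Var) (p r : List Var) :
    BlockLang P (.b :: τ) (fun l => YCond l ∧ XCond l)
        (p ++ (interleavedWord P τ [.x, .z .d, .z .c, .z .e, .y]).flatMap φ ++ r) ↔
      BlockLang P (.b :: τ) (fun l => YCond l ∧ XCond l)
        (p ++ (interleavedWord P τ [.z .d, .x, .z .c, .y, .z .e]).flatMap φ ++ r) := by
  have hC : ∀ l l', BlockEquiv l l' → (YCond l ∧ XCond l ↔ YCond l' ∧ XCond l') :=
    fun _ _ h => and_congr h.yCond h.xCond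
  -- The intermediate word x z_d z_c y z_e splits the identity into two adjacent swaps. In the first
  -- one `XCond` is unaffected and may be assumed when `YCond` is compared; in the second one the
  -- roles are exchanged.
  refine (blockLang_iff hP hτ hPτ (H' := [.x, .z .d, .z .c, .y, .z .e]) (List.Perm.swap _ _ _)
    (by rw [List.perm_iff_count]; intro v; simp only [List.count_cons]; omega)
    (fun hφ p h' => ?_) p r).trans
    (blockLang_iff hP hτ hPτ
      (by rw [List.perm_iff_count]; intro v; simp only [List.count_cons]; omega)
      (by rw [List.perm_iff_count]; intro v; simp only [List.count_cons]; omega)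
      (fun hφ p h' => ?_) p r)
  · have := block_swap_iff hP hC hφ (G := blockHead P ++ [.x, .z .d, .z .c])
      [] (Or.inr rfl) (by simp [blockHead]) (q := .e) (by simp [zOrder]) p h' ?_
    · simpa only [List.append_assoc, List.cons_append, List.nil_append] using this
    intro m h₁ hl hzs hgl
    have hx : m = .d ∨ m = .c →
        List.count Var.x (p ++ List.flatMap φ (blockHead P ++ [.x, .z .d, .z .c])) = 1 →
          .x ∉ φ .y := by
      intro hm hc
      rw [blockHead_append] at h₁ hc
      have hM := eq_x_or_z_of_mem (P := P) (H := [Var.x, Var.z .d, Var.z .c]) (by simp)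
      exact x_not_mem_subst_y hP hφ hM (by simp) hm h₁ hc
    have hX := xCond_swap (k := [].flatMap φ ++ h') hl hzs hgl hx
    rw [← hX, and_congr_left_iff]
    intro hX'
    refine yCond_swap hl hzs hgl ?_
    rintro rfl hc
    rw [blockHead_append] at h₁ hX' hc
    exact y_not_mem_subst_y hP hφ h₁ hX' hc
  · refine (block_swap_iff hP hC hφ _ (Or.inl rfl) (by simp [blockHead])
      (by simp [zOrder]) p h' ?_).symm
    intro m h₁ hl hzs hgl
    have hY := yCond_swap (k := [.z .c, .y, .z .e].flatMap φ ++ h') hl hzs hgl fun hm hc => by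
      subst hm
      exact y_not_mem_subst_x hP hφ h₁ hc
    rw [← hY, and_congr_right_iff]
    intro hY'
    refine xCond_swap hl hzs hgl ?_
    intro hm hc
    simp only [List.flatMap_cons, List.append_assoc] at h₁ hY'
    refine x_not_mem_subst_x hP hφ (k := φ (.z .e) ++ ([].flatMap φ ++ h')) hm ?_ ?_ hc
    · simpa only [blockHead, List.flatMap_cons, List.append_assoc] using h₁
    · simpa only [blockHead, List.flatMap_cons, List.append_assoc] using hY'

end Identities

/-! ### The word `â_{0,k}[π]` as a list -/

section HatWord

variable {m : ℕ} (π : Equiv.Perm (Fin (m + 1)))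

/-- The index of the last letter between the two occurrences of `x`. -/
def lastIndex : ℕ := (π (Fin.last m) : ℕ)

/-- The remaining letters between the two occurrences of `x`. -/
def hatInit : List Letter := List.ofFn fun i : Fin m => Letter.z (π i.castSucc)

def hatTail (n : ℕ) (f : ℕ → ℕ) : List Letter :=
  (List.range n).flatMap fun i => .t i :: List.replicate (f i + 1) (.z i)

def hatWord : List Letter :=
  .x :: (hatInit π ++ .z (lastIndex π) :: .x :: hatTail (m + 1) 0)

theorem toList_prod_ofFn {A : Type} {n : ℕ} (f : Fin n → FreeMonoid A) :
    (List.ofFn f).prod.toList = (List.ofFn fun i => (f i).toList).flatten := by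
  rw [FreeMonoid.toList_prod, List.map_ofFn]
  rfl

theorem toList_hatA : (hatA (m + 1) π).toList = hatWord π := by
  have h₁ : (List.ofFn fun i : Fin (m + 1) => [Letter.z (π i)]).flatten =
      hatInit π ++ [.z (lastIndex π)] := by
    rw [List.ofFn_succ', List.concat_eq_append, List.flatten_append]
    congr 1
    unfold hatInit
    generalize (fun i : Fin m => π i.castSucc) = g
    have : ∀ {n : ℕ} (g : Fin n → Letter), (List.ofFn fun i => [g i]).flatten = List.ofFn g := by
      intro n g
      induction n with
      | zero => simp
      | succ n ih => simp [List.ofFn_succ, ih]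
    exact this fun i => Letter.z (π i.castSucc)
  have h₂ : (List.ofFn fun i : Fin (m + 1) => [Letter.t i, Letter.z i]).flatten =
      hatTail (m + 1) 0 := by
    unfold hatTail
    rw [← List.map_coe_finRange_eq_range, List.flatMap_map, List.flatMap_def, List.ofFn_eq_map]
    rfl
  simp only [hatA, FreeMonoid.toList_mul, toList_prod_ofFn, FreeMonoid.toList_of,
    List.singleton_append, h₁, h₂]
  simp [hatWord]

theorem mem_hatTail {n : ℕ} {f : ℕ → ℕ} {v : Letter} :
    v ∈ hatTail n f ↔ ∃ i < n, v = .t i ∨ v = .z i := by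
  simp [hatTail]

theorem mem_hatInit {v : Letter} : v ∈ hatInit π → ∃ i, v = .z i ∧ i ≠ lastIndex π := by
  simp only [hatInit, List.mem_ofFn]
  rintro ⟨i, rfl⟩
  refine ⟨_, rfl, fun h => ?_⟩
  have := π.injective (Fin.ext h)
  exact absurd this (Fin.castSucc_lt_last i).ne

theorem z_mem_hatInit {i : ℕ} (hi : i < m + 1) : Letter.z i ∈ hatInit π ++ [.z (lastIndex π)] := by
  obtain ⟨j, hj⟩ := π.surjective ⟨i, hi⟩
  induction j using Fin.lastCases with
  | last => simp [lastIndex, hj]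
  | cast j =>
    refine List.mem_append_left _ ?_
    simp only [hatInit, List.mem_ofFn]
    exact ⟨j, by rw [hj]⟩

theorem lambdaRel_flatMap {L : List ℕ} (f : ℕ → ℕ) {l : List Letter}
    (h : ∀ i ∈ L, Letter.z i ∈ l) :
    LambdaRel (l ++ L.flatMap fun i => .t i :: List.replicate (f i + 1) (.z i))
      (l ++ L.flatMap fun i => [.t i, .z i]) := by
  induction L generalizing l with
  | nil => exact LambdaRel.rfl
  | cons i L ih =>
    have h₁ := lambdaRel_replicate (l₁ := l ++ [.t i]) (a := Letter.z i)
      (by simp [h i List.mem_cons_self]) (f i)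
      (L.flatMap fun i => .t i :: List.replicate (f i + 1) (.z i))
    have h₂ := ih (l := l ++ [.t i, .z i]) fun j hj => by simp [h j (List.mem_cons_of_mem _ hj)]
    simp only [List.append_assoc, List.cons_append, List.nil_append] at h₁ h₂
    simpa using h₁.trans h₂

/-- The run of x's and the z's in the tail are not first occurrences, so their exponents are free.
-/
theorem lambdaRel_hatWord (n : ℕ) (f : ℕ → ℕ) :
    LambdaRel (.x :: (hatInit π ++ .z (lastIndex π) ::
      (List.replicate (n + 1) .x ++ hatTail (m + 1) f))) (hatWord π) := by
  have h₁ := lambdaRel_replicate (l₁ := .x :: (hatInit π ++ [.z (lastIndex π)])) (a := Letter.x)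
    (by simp) n (hatTail (m + 1) f)
  have h₂ := lambdaRel_flatMap (L := List.range (m + 1)) f
    (l := .x :: (hatInit π ++ .z (lastIndex π) :: [.x])) fun i hi => by
      have := z_mem_hatInit π (List.mem_range.1 hi)
      simp at this ⊢
      tauto
  simp only [List.append_assoc, List.cons_append, List.nil_append] at h₁ h₂
  exact h₁.trans h₂

theorem z_not_mem_hatInit : Letter.z (lastIndex π) ∉ hatInit π := fun h => by
  obtain ⟨i, h, hi⟩ := mem_hatInit π h
  exact hi (Letter.z.inj h).symm

theorem x_not_mem_hatInit : Letter.x ∉ hatInit π := fun h => by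
  obtain ⟨i, h, -⟩ := mem_hatInit π h
  cases h

theorem count_x_hatInit : (hatInit π).count .x = 0 :=
  List.count_eq_zero_of_not_mem (x_not_mem_hatInit π)

theorem count_x_hatTail (n : ℕ) (f : ℕ → ℕ) : (hatTail n f).count .x = 0 := by
  rw [List.count_eq_zero, mem_hatTail]
  simp

theorem count_takeWhile_of_lambdaRel {v : List Letter} (h : LambdaRel v (hatWord π)) :
    (v.takeWhile (· ≠ .z (lastIndex π))).count .x = 1 := by
  refine h.symm.count_takeWhile_eq_one (by simp) (by simp [hatWord]) ?_
  have : hatWord π = (.x :: hatInit π) ++ (.z (lastIndex π) :: .x :: hatTail (m + 1) 0) := rfl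
  rw [this, List.takeWhile_append_of_pos]
  · simp [count_x_hatInit]
  · intro w hw
    rcases List.mem_cons.1 hw with rfl | hw
    · simp
    · obtain ⟨i, rfl, hi⟩ := mem_hatInit π hw
      simpa using hi

theorem count_x_hatWord : (hatWord π).count .x = 2 := by
  simp [hatWord, count_x_hatInit, count_x_hatTail]

theorem head?_hatInit_append (l : List Letter) :
    (hatInit π ++ .z (lastIndex π) :: l).head? ≠ some .x := by
  intro h
  cases hI : hatInit π with
  | nil => simp [hI] at h
  | cons v I =>
    rw [hI] at h
    simp only [List.cons_append, List.head?_cons, Option.some.injEq] at h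
    exact x_not_mem_hatInit π (by simp [hI, h])

theorem not_firstTwoAdjacent_x : ¬ FirstTwoAdjacent .x (hatWord π) := by
  have e : hatWord π = [.x] ++ (hatInit π ++ .z (lastIndex π) :: .x :: hatTail (m + 1) 0) := rfl
  rw [e, firstTwoAdjacent_append]
  rintro (h | h | h)
  · simpa using h.two_le_count
  · simp at h
  · exact head?_hatInit_append π _ h.2.2

theorem count_t_hatWord : (hatWord π).count (.t 0) = 1 := by
  have h₁ : Letter.t 0 ∉ hatInit π := fun h => by
    obtain ⟨i, h, -⟩ := mem_hatInit π h
    cases h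
  have h₂ : (hatTail (m + 1) 0).count (.t 0) = 1 := by
    rw [hatTail, List.range_succ_eq_map, List.flatMap_cons, List.count_append]
    have : (((List.range m).map Nat.succ).flatMap fun i =>
        Letter.t i :: List.replicate ((0 : ℕ → ℕ) i + 1) (.z i)).count (.t 0) = 0 := by
      rw [List.count_eq_zero]
      simp
    rw [this]
    simp
  simp [hatWord, List.count_eq_zero_of_not_mem h₁, h₂]

theorem getLast?_hatTail : (hatTail (m + 1) 0).getLast? = some (.z m) := by
  rw [hatTail, List.range_succ, List.flatMap_append]
  simp

theorem getLast?_hatWord : (hatWord π).getLast? = some (.z m) := by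
  have e : hatWord π = (.x :: (hatInit π ++ [.z (lastIndex π), .x])) ++ hatTail (m + 1) 0 := by
    simp [hatWord]
  rw [e, List.getLast?_append, getLast?_hatTail]
  rfl

end HatWord

/-! ### Properties of words detected by substitutions into factors of â -/

section Indistinguishable

variable {m : ℕ} (π : Equiv.Perm (Fin (m + 1)))

/-- Every substitution that maps `u` to a factor of the class of `hatWord π` maps `v` to the same
factor. -/
def Indist (u v : List Var) : Prop :=
  ∀ (φ : Var → List Letter) (p s : List Letter),
    LambdaRel (p ++ (u.flatMap φ ++ s)) (hatWord π) →
      LambdaRel (p ++ (v.flatMap φ ++ s)) (hatWord π)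

theorem getLast?_append_replicate {A : Type} (l : List A) (n : ℕ) (a : A) :
    (l ++ List.replicate (n + 1) a).getLast? = some a := by
  rw [List.replicate_succ', ← List.append_assoc, List.getLast?_concat]

theorem flatMap_eq_replicate {φ : Var → List Letter} {d : Var} {a : Letter} (hd : φ d = [a])
    {w : List Var} (h : ∀ v ∈ w, v = d ∨ φ v = []) :
    w.flatMap φ = List.replicate (w.count d) a := by
  induction w with
  | nil => simp
  | cons v w ih =>
    have ih := ih fun v hv => h v (List.mem_cons_of_mem _ hv)
    rw [List.flatMap_cons, ih, List.count_cons]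
    by_cases hv : v = d
    · subst hv; simp [hd, List.replicate_succ]
    · have := (h v List.mem_cons_self).resolve_left hv
      simp [this, hv]

/-- The substitution `d ↦ r`, `s ↦ r'` that deletes all other letters. -/
def subst₂ (d : Var) (r : List Letter) (s : Var) (r' : List Letter) : Var → List Letter :=
  fun v => if v = d then r else if v = s then r' else []

theorem flatMap_subst₂ {d s : Var} {a : Letter} {r' : List Letter} {w : List Var} (h : s ∉ w) :
    w.flatMap (subst₂ d [a] s r') = List.replicate (w.count d) a := by
  refine flatMap_eq_replicate (by simp [subst₂]) fun v hv => ?_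
  by_cases hd : v = d
  · exact Or.inl hd
  · refine Or.inr ?_
    have : v ≠ s := fun e => h (e ▸ hv)
    simp [subst₂, hd, this]

theorem flatMap_subst₂_split {d s : Var} (hds : s ≠ d) {a : Letter} {r' : List Letter}
    {w₁ w₂ : List Var} (h₁ : s ∉ w₁) (h₂ : s ∉ w₂) :
    (w₁ ++ s :: w₂).flatMap (subst₂ d [a] s r') =
      List.replicate (w₁.count d) a ++ (r' ++ List.replicate (w₂.count d) a) := by
  rw [List.flatMap_append, List.flatMap_cons, flatMap_subst₂ h₁, flatMap_subst₂ h₂]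
  simp [subst₂, hds]

variable {π} {u v : List Var} (h : Indist π u v)
include h

/-- Mapping d to t_0 and appending the image to â would destroy the simplicity of t_0. -/
theorem Indist.not_mem {d : Var} (hd : d ∉ u) : d ∉ v := by
  have h₁ := h (subst₂ d [.t 0] d []) (hatWord π) []
  have e : ∀ w : List Var, w.flatMap (subst₂ d [.t 0] d []) = List.replicate (w.count d) (.t 0) :=
    fun w => flatMap_eq_replicate (by simp [subst₂]) fun v _ => by
      by_cases hv : v = d
      · exact Or.inl hv
      · exact Or.inr (by simp [subst₂, hv])
  rw [e, e, List.count_eq_zero_of_not_mem hd] at h₁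
  have h₂ := (h₁ (by simpa using LambdaRel.rfl)).1 (.t 0)
  have h₃ := count_t_hatWord π
  simp only [h₃, List.count_append, List.count_replicate] at h₂
  rw [← List.count_eq_zero]
  simpa using h₂

theorem Indist.count_eq_one {d : Var} (hd : u.count d = 1) : v.count d = 1 := by
  have h₀ := count_t_hatWord π
  obtain ⟨p, s, hps⟩ := List.append_of_mem (List.count_pos_iff.1 (h₀.symm ▸ Nat.one_pos))
  have h₁ := h (subst₂ d [.t 0] d []) p s
  have e : ∀ w : List Var, w.flatMap (subst₂ d [.t 0] d []) = List.replicate (w.count d) (.t 0) :=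
    fun w => flatMap_eq_replicate (by simp [subst₂]) fun v _ => by
      by_cases hv : v = d
      · exact Or.inl hv
      · exact Or.inr (by simp [subst₂, hv])
  rw [e, e, hd, hps] at h₁
  rw [hps] at h₀
  have h₂ := ((h₁ (by simpa using LambdaRel.rfl)).1 (.t 0)).2 h₀
  simp only [List.count_append, List.count_replicate_self, List.count_cons_self] at h₀ h₂
  omega

/-- The first occurrence of `d` is separated from the others by the simple letter `s`. -/
theorem Indist.count_left_eq_one {d s : Var} (hds : s ≠ d) {u₁ u₂ v₁ v₂ : List Var}
    (hu : u = u₁ ++ s :: u₂) (hv : v = v₁ ++ s :: v₂) (hu₁ : s ∉ u₁) (hu₂ : s ∉ u₂) (hv₁ : s ∉ v₁)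
    (hv₂ : s ∉ v₂) (h₁ : u₁.count d = 1) (h₂ : d ∈ u₂) : v₁.count d = 1 ∧ d ∈ v₂ := by
  have h₃ := h (subst₂ d [.x] s (hatInit π ++ [.z (lastIndex π)])) [] (hatTail (m + 1) 0)
  rw [hu, hv, flatMap_subst₂_split hds hu₁ hu₂, flatMap_subst₂_split hds hv₁ hv₂, h₁] at h₃
  obtain ⟨n, hn⟩ := Nat.exists_eq_add_of_lt (List.count_pos_iff.2 h₂)
  have h₄ := h₃ (by
    rw [hn]
    have := lambdaRel_hatWord π n 0
    simpa using this)
  clear h₃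
  rw [← List.count_pos_iff]
  -- With no d on the left the image does not begin with x; with one d on the left and none on the
  -- right x becomes simple; with two or more on the left the first two x's are adjacent.
  rcases hc : v₁.count d with _ | _ | c
  · rw [hc] at h₄
    have := h₄.head?_eq
    simp only [List.nil_append, List.replicate_zero, List.append_assoc, List.cons_append] at this
    exact absurd (by rw [this]; rfl) (head?_hatInit_append π
      (List.replicate (v₂.count d) .x ++ hatTail (m + 1) 0))
  · refine ⟨rfl, ?_⟩
    by_contra h₅
    have h₆ := h₄.1 .x
    have h₇ : v₂.count d = 0 := by omega
    simp [hc, h₇, count_x_hatInit, count_x_hatTail, count_x_hatWord] at h₆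
  · rw [hc] at h₄
    refine absurd ((h₄.2.2 .x).1 ⟨[], List.replicate c .x ++ (hatInit π ++
      [Letter.z (lastIndex π)] ++ List.replicate (v₂.count d) .x) ++ hatTail (m + 1) 0,
      by simp, ?_⟩) (not_firstTwoAdjacent_x π)
    simp only [List.nil_append, List.replicate_succ, List.cons_append]

/-- The letter s is mapped to the tail of â, so a d to its right would put an x at the end, where â
has a z. -/
theorem Indist.not_mem_right {d s : Var} (hds : s ≠ d) {u₁ u₂ v₁ v₂ : List Var}
    (hu : u = u₁ ++ s :: u₂) (hv : v = v₁ ++ s :: v₂) (hu₁ : s ∉ u₁) (hu₂ : s ∉ u₂) (hv₁ : s ∉ v₁)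
    (hv₂ : s ∉ v₂) (h₁ : d ∈ u₁) (h₂ : d ∉ u₂) : d ∉ v₂ := by
  have h₃ := h (subst₂ d [.x] s (hatTail (m + 1) 0))
    (.x :: (hatInit π ++ [.z (lastIndex π)])) []
  rw [hu, hv, flatMap_subst₂_split hds hu₁ hu₂, flatMap_subst₂_split hds hv₁ hv₂,
    List.count_eq_zero_of_not_mem h₂] at h₃
  obtain ⟨n, hn⟩ := Nat.exists_eq_add_of_lt (List.count_pos_iff.2 h₁)
  have h₄ := h₃ (by
    rw [hn]
    have := lambdaRel_hatWord π n 0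
    simpa using this)
  intro h₅
  obtain ⟨c, hc⟩ := Nat.exists_eq_add_of_lt (List.count_pos_iff.2 h₅)
  have h₆ := h₄.getLast?_eq
  rw [getLast?_hatWord, hc, zero_add, List.append_nil, ← List.append_assoc,
    ← List.append_assoc, getLast?_append_replicate] at h₆
  simp at h₆

/-- The order of two simple letters. -/
theorem Indist.simple_order {d s : Var} (hds : s ≠ d) {u₁ u₂ v₁ v₂ : List Var}
    (hu : u = u₁ ++ s :: u₂) (hv : v = v₁ ++ s :: v₂) (hu₁ : s ∉ u₁) (hu₂ : s ∉ u₂) (hv₁ : s ∉ v₁)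
    (hv₂ : s ∉ v₂) (h₁ : u₁.count d = 1) (h₂ : d ∉ u₂) : d ∉ v₂ := by
  have h₃ := h (subst₂ d [.x] s (hatInit π ++ .z (lastIndex π) :: .x :: hatTail (m + 1) 0)) [] []
  rw [hu, hv, flatMap_subst₂_split hds hu₁ hu₂, flatMap_subst₂_split hds hv₁ hv₂, h₁,
    List.count_eq_zero_of_not_mem h₂] at h₃
  have h₄ := (h₃ (by simpa [hatWord] using LambdaRel.rfl)).getLast?_eq
  intro h₅
  obtain ⟨c, hc⟩ := Nat.exists_eq_add_of_lt (List.count_pos_iff.2 h₅)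
  rw [getLast?_hatWord, hc, zero_add, List.append_nil, ← List.append_assoc,
    ← List.append_assoc, getLast?_append_replicate] at h₄
  simp at h₄

/-- If the first occurrence of `q` precedes that of `d`, and only `q` occurs on the right of the
simple letter `s`, then the same is true in every indistinguishable word. -/
theorem Indist.not_mem_left {d q s : Var} (hds : s ≠ d) (hqs : s ≠ q) (hdq : d ≠ q)
    {u₁ u₂ u₃ v₁ v₂ v₃ : List Var}
    (hu : u = u₁ ++ q :: (u₂ ++ s :: u₃)) (hv : v = v₁ ++ q :: (v₂ ++ s :: v₃))
    (hus : s ∉ u₁ ∧ s ∉ u₂ ∧ s ∉ u₃) (hvs : s ∉ v₁ ∧ s ∉ v₂ ∧ s ∉ v₃)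
    (huq : q ∉ u₁ ∧ q ∉ u₂ ∧ q ∈ u₃) (hvq : q ∉ v₁)
    (hud : d ∉ u₁ ∧ d ∈ u₂ ∧ d ∉ u₃) : d ∉ v₁ := by
  have hz : Letter.z (lastIndex π) ∈ hatTail (m + 1) 0 :=
    mem_hatTail.2 ⟨_, (π (Fin.last m)).isLt, Or.inr rfl⟩
  -- The tail of â is cut at the second occurrence of its last inner z: s produces the part before
  -- it, the q's to the right of s produce a power of that z, and the rest is the right context.
  obtain ⟨r, r', hr⟩ := List.append_of_mem hz
  let φ : Var → List Letter := fun v =>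
    if v = d then [.x] else if v = q then [.z (lastIndex π)] else if v = s then r else []
  have hφd : φ d = [.x] := by simp [φ]
  have hφq : φ q = [.z (lastIndex π)] := by simp [φ, hdq.symm]
  have hφs : φ s = r := by simp [φ, hds, hqs]
  have hφ : ∀ v, v ≠ d → v ≠ q → v ≠ s → φ v = [] := fun v h₁ h₂ h₃ => by simp [φ, h₁, h₂, h₃]
  have hx : ∀ w : List Var, q ∉ w → s ∉ w →
      w.flatMap φ = List.replicate (w.count d) .x := by
    intro w h₁ h₂
    refine flatMap_eq_replicate hφd fun v hv => ?_
    by_cases hvd : v = d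
    · exact Or.inl hvd
    · exact Or.inr (hφ v hvd (fun e => h₁ (e ▸ hv)) fun e => h₂ (e ▸ hv))
  have hq : ∀ w : List Var, d ∉ w → s ∉ w →
      w.flatMap φ = List.replicate (w.count q) (.z (lastIndex π)) := by
    intro w h₁ h₂
    refine flatMap_eq_replicate hφq fun v hv => ?_
    by_cases hvd : v = q
    · exact Or.inl hvd
    · exact Or.inr (hφ v (fun e => h₁ (e ▸ hv)) hvd fun e => h₂ (e ▸ hv))
  have h₁ := h φ (.x :: hatInit π) r'
  rw [hu, hv] at h₁
  simp only [List.flatMap_append, List.flatMap_cons, hφq, hφs, hx u₁ huq.1 hus.1,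
    hx u₂ huq.2.1 hus.2.1, hq u₃ hud.2.2 hus.2.2, hx v₁ hvq hvs.1,
    List.count_eq_zero_of_not_mem hud.1] at h₁
  obtain ⟨n, hn⟩ := Nat.exists_eq_add_of_lt (List.count_pos_iff.2 hud.2.1)
  obtain ⟨n', hn'⟩ := Nat.exists_eq_add_of_lt (List.count_pos_iff.2 huq.2.2)
  have h₂ := h₁ (by
    rw [hn, hn', zero_add, zero_add]
    have h₂ := lambdaRel_replicate (l₁ := .x :: (hatInit π ++ [.z (lastIndex π)]))
      (a := Letter.x) (by simp) n (r ++ .z (lastIndex π) :: r')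
    have h₃ := lambdaRel_replicate
      (l₁ := .x :: (hatInit π ++ .z (lastIndex π) :: (List.replicate (n + 1) .x ++ r)))
      (a := Letter.z (lastIndex π)) (by simp) n' r'
    simp only [List.append_assoc, List.cons_append, List.nil_append] at h₂ h₃
    rw [← hr] at h₂
    simpa using h₃.trans (by rw [← hr]; exact h₂))
  -- The left context already contains the one x allowed before the first q, so `v₁` cannot
  -- contribute another.
  have h₃ := count_takeWhile_of_lambdaRel π h₂
  have h₄ : ∀ w ∈ (.x :: hatInit π) ++ List.replicate (v₁.count d) Letter.x,
      decide (w ≠ Letter.z (lastIndex π)) = true := by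
    intro w hw
    simp only [List.mem_append, List.mem_cons, List.mem_replicate] at hw
    rcases hw with (rfl | hw) | ⟨-, rfl⟩
    · simp
    · refine decide_eq_true fun e => z_not_mem_hatInit π ?_
      rwa [← e]
    · simp
  have h₅ : ∀ k k' : List Letter, ((.x :: hatInit π) ++ ((List.replicate (v₁.count d) .x ++
      ([.z (lastIndex π)] ++ k)) ++ k')) =
      ((.x :: hatInit π) ++ List.replicate (v₁.count d) .x) ++
      (.z (lastIndex π) :: (k ++ k')) := by intro k k'; simp
  rw [h₅, List.takeWhile_append_of_pos h₄] at h₃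
  simp [count_x_hatInit] at h₃
  exact List.count_eq_zero.1 h₃

end Indistinguishable

/-! ### Reconstruction of the tail -/

structure IsTail (T : List ZIndex) (R : List Var) : Prop where
  mem : ∀ v ∈ R, ∃ q ∈ T, v = .t q ∨ v = .z q
  count : ∀ q ∈ T, R.count (.t q) = 1
  split : ∀ T₁ q T₂ R₁ R₂, T = T₁ ++ q :: T₂ → R = R₁ ++ .t q :: R₂ →
    .z q ∉ R₁ ∧ .z q ∈ R₂ ∧ (∀ q' ∈ T₂, .t q' ∈ R₂) ∧ ∀ q' ∈ T₁, .z q' ∉ R₂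

theorem tailWord_congr {T : List ZIndex} {f g : ZIndex → ℕ} (h : ∀ q ∈ T, f q = g q) :
    tailWord T f = tailWord T g := by
  unfold tailWord
  exact List.flatMap_congr fun q hq => by rw [h q hq]

/-- Only z_q can stand between t_q and the next t: every t is simple, no z_r precedes its t_r here,
and z_q does not occur after the next t. -/
theorem IsTail.exists_eq_tailWord {T : List ZIndex} {q : ZIndex}
    {R : List Var} (hqT : (q :: T).Nodup) (h : IsTail (q :: T) (.t q :: R)) :
    ∃ f, .t q :: R = tailWord (q :: T) f := by
  induction T generalizing q R with
  | nil =>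
    have h₁ : ∀ v ∈ R, v = .z q := by
      intro v hv
      obtain ⟨r, hr, h'⟩ := h.mem v (List.mem_cons_of_mem _ hv)
      rw [List.mem_singleton] at hr
      subst hr
      refine h'.resolve_left ?_
      rintro rfl
      have := h.count r (by simp)
      rw [List.count_cons_self] at this
      exact absurd (List.count_pos_iff.2 hv) (by omega)
    have h₂ := (h.split [] q [] [] R rfl rfl).2.1
    have h₃ := List.length_pos_of_mem h₂
    refine ⟨fun _ => R.length - 1, ?_⟩
    rw [tailWord_cons, Nat.sub_add_cancel h₃, ← List.eq_replicate_of_mem h₁]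
    simp [tailWord]
  | cons q' T ih =>
    obtain ⟨-, h₂, h₃, -⟩ := h.split [] q (q' :: T) [] R rfl rfl
    obtain ⟨hqnot, hT'⟩ := List.nodup_cons.1 hqT
    obtain ⟨A, B, rfl⟩ := List.append_of_mem (h₃ q' (by simp))
    obtain ⟨-, h₄, h₅, h₆⟩ := h.split [q] q' T (.t q :: A) B rfl rfl
    have hAz : ∀ v ∈ A, v = .z q := by
      intro v hv
      obtain ⟨r, hr, h'⟩ := h.mem v (by simp [hv])
      rcases List.mem_cons.1 hr with rfl | hr'
      · refine h'.resolve_left ?_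
        rintro rfl
        have := h.count r (by simp)
        rw [List.count_cons_self, List.count_append] at this
        have := List.count_pos_iff.2 hv
        omega
      · exfalso
        have hrR : .t r ∈ Var.t q' :: B := by
          rcases List.mem_cons.1 hr' with rfl | hr''
          · simp
          · exact List.mem_cons_of_mem _ (h₅ r hr'')
        rcases h' with rfl | rfl
        · have := h.count r hr
          rw [List.count_cons, List.count_append] at this
          have h₇ := List.count_pos_iff.2 hv
          have h₈ := List.count_pos_iff.2 hrR
          omega
        · obtain ⟨B₁, B₂, hB⟩ := List.append_of_mem hrR
          obtain ⟨T₁, T₂, hT₁⟩ := List.append_of_mem hr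
          exact (h.split T₁ r T₂ (.t q :: (A ++ B₁)) B₂ hT₁ (by simp [hB])).1 (by simp [hv])
    have hqA : .z q ∈ A := by
      rw [List.mem_append, List.mem_cons] at h₂
      rcases h₂ with h₂ | h₂ | h₂
      · exact h₂
      · cases h₂
      · exact absurd h₂ (h₆ q (by simp))
    have hrest : IsTail (q' :: T) (.t q' :: B) := by
      refine ⟨fun v hv => ?_, fun r hr => ?_, fun T₁ r T₂ R₁ R₂ hT₁ hR => ?_⟩
      · obtain ⟨r, hr, h'⟩ := h.mem v (List.mem_cons_of_mem _ (List.mem_append_right _ hv))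
        rcases List.mem_cons.1 hr with rfl | hr
        · rcases h' with rfl | rfl
          · have := h.count r (by simp)
            rw [List.count_cons_self, List.count_append] at this
            have := List.count_pos_iff.2 hv
            omega
          · refine absurd ?_ (h₆ r (by simp))
            simpa using hv
        · exact ⟨r, hr, h'⟩
      · have h₇ := h.count r (List.mem_cons_of_mem _ hr)
        have h₈ : (Var.t q :: A).count (.t r) = 0 := by
          rw [List.count_eq_zero, List.mem_cons]
          rintro (h' | h')
          · cases h'
            exact hqnot hr
          · cases hAz _ h'
        rw [← List.cons_append, List.count_append, h₈, zero_add] at h₇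
        exact h₇
      · obtain ⟨h₇, h₈, h₉, h₁₀⟩ := h.split (q :: T₁) r T₂ (.t q :: (A ++ R₁)) R₂ (by simp [hT₁])
          (by simp [hR])
        exact ⟨fun h' => h₇ (by simp [h']), h₈, h₉, fun r hr => h₁₀ r (by simp [hr])⟩
    obtain ⟨g, hg⟩ := ih hT' hrest
    refine ⟨fun r => if r = q then A.length - 1 else g r, ?_⟩
    have h₁₁ := List.length_pos_of_mem hqA
    have h₁₂ : tailWord (q' :: T) (fun r => if r = q then A.length - 1 else g r) =
        tailWord (q' :: T) g := tailWord_congr fun r hr => by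
      rw [if_neg]
      rintro rfl
      exact hqnot hr
    rw [tailWord_cons, h₁₂, ← hg, if_pos rfl, Nat.sub_add_cancel h₁₁,
      ← List.eq_replicate_of_mem hAz]

/-- Words consisting of a block and a tail, with an arbitrary order inside the block. -/
structure IsPreBlock (T : List ZIndex) (l : List Var) : Prop where
  not_t : ∀ q, .t q ∉ l
  count_z : ∀ q ∈ T, l.count (.z q) = 1
  mem : ∀ v ∈ l, v = .x ∨ v = .y ∨ ∃ q ∈ T, v = .z q
  count_x : 2 ≤ l.count .x
  count_y : 2 ≤ l.count .y

theorem not_mem_of_count_append_cons {v : Var} {l k : List Var} (h : (l ++ v :: k).count v = 1) :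
    v ∉ l ∧ v ∉ k := by
  rw [List.count_append, List.count_cons_self] at h
  exact ⟨List.count_eq_zero.1 (by omega), List.count_eq_zero.1 (by omega)⟩

section Saturation

variable {m : ℕ} {π : Equiv.Perm (Fin (m + 1))} {q₀ : ZIndex} {T : List ZIndex}

theorem tailWord_split (T₁ : List ZIndex) (q : ZIndex) (T₂ : List ZIndex) (f : ZIndex → ℕ) :
    tailWord (T₁ ++ q :: T₂) f =
      tailWord T₁ f ++ .t q :: (List.replicate (f q + 1) (.z q) ++ tailWord T₂ f) := by
  simp [tailWord]

theorem count_t_preBlock {l : List Var} (hT : T.Nodup) (hl : IsPreBlock T l) (f : ZIndex → ℕ)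
    {q : ZIndex} (hq : q ∈ T) : (l ++ tailWord T f).count (.t q) = 1 := by
  have h₁ := count_t_tailWord_le hT f q
  have h₂ : 0 < (tailWord T f).count (.t q) :=
    List.count_pos_iff.2 (mem_tailWord.2 ⟨q, hq, Or.inl rfl⟩)
  rw [List.count_append, List.count_eq_zero_of_not_mem (hl.not_t q)]
  omega

/-- Each t_q is simple and serves as the separator in the preceding tests. The tests at t_{q₀}
describe the block, where every z occurs once; all of them together yield `IsTail` for the
remainder. -/
theorem Indist.exists_preBlock (hT : (q₀ :: T).Nodup) {u v : List Var} (h : Indist π u v)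
    (h' : Indist π v u) {l : List Var} {f : ZIndex → ℕ} (hl : IsPreBlock (q₀ :: T) l)
    (hu : u = l ++ tailWord (q₀ :: T) f) :
    ∃ l' f', v = l' ++ tailWord (q₀ :: T) f' ∧ IsPreBlock (q₀ :: T) l' := by
  have htu : ∀ q ∈ q₀ :: T, u.count (.t q) = 1 := fun q hq => by
    rw [hu]; exact count_t_preBlock hT hl f hq
  have htv : ∀ q ∈ q₀ :: T, v.count (.t q) = 1 := fun q hq => h.count_eq_one (htu q hq)
  have hmem : ∀ w ∈ v, w ∈ u := fun w hw => by
    by_contra hn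
    exact h.not_mem hn hw
  have hletters : ∀ w ∈ u, w = .x ∨ w = .y ∨ ∃ q ∈ q₀ :: T, w = .t q ∨ w = .z q := by
    intro w hw
    rw [hu, List.mem_append] at hw
    rcases hw with hw | hw
    · rcases hl.mem w hw with h | h | ⟨q, hq, h⟩
      · exact Or.inl h
      · exact Or.inr (Or.inl h)
      · exact Or.inr (Or.inr ⟨q, hq, Or.inr h⟩)
    · exact Or.inr (Or.inr (mem_tailWord.1 hw))
  have hsplit : ∀ T₁ q T₂ v₁ v₂, q₀ :: T = T₁ ++ q :: T₂ → v = v₁ ++ .t q :: v₂ →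
      v₁.count (.z q) = 1 ∧ .z q ∈ v₂ ∧ (∀ q' ∈ T₂, .t q' ∈ v₂) ∧ (∀ q' ∈ T₁, .z q' ∉ v₂) ∧
        (∀ q' ∈ q₀ :: T, T₁ = [] → v₁.count (.z q') = 1) ∧ .x ∉ v₂ ∧ .y ∉ v₂ := by
    intro T₁ q T₂ v₁ v₂ hq hv
    have hqT : q ∈ q₀ :: T := by rw [hq]; simp
    have hu' : u = (l ++ tailWord T₁ f) ++
        .t q :: (List.replicate (f q + 1) (.z q) ++ tailWord T₂ f) := by
      rw [hu, hq, tailWord_split]; simp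
    have hcu := htu q hqT
    rw [hu'] at hcu
    obtain ⟨hu₁, hu₂⟩ := not_mem_of_count_append_cons hcu
    have hcv := htv q hqT
    rw [hv] at hcv
    obtain ⟨hv₁, hv₂⟩ := not_mem_of_count_append_cons hcv
    rw [hq, List.nodup_append, List.nodup_cons] at hT
    obtain ⟨-, ⟨hqT₂, -⟩, hdisj⟩ := hT
    have hqT₁ : q ∉ T₁ := fun h => hdisj q h q (by simp) rfl
    have hz : (l ++ tailWord T₁ f).count (.z q) = 1 := by
      rw [List.count_append, hl.count_z q hqT, List.count_eq_zero_of_not_mem]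
      rw [mem_tailWord]
      rintro ⟨r, hr, h | h⟩
      · cases h
      · cases h; exact hqT₁ hr
    obtain ⟨h₁, h₂⟩ := h.count_left_eq_one (d := .z q) (by simp) hu' hv hu₁ hu₂ hv₁ hv₂ hz (by simp)
    have hxy : ∀ w, w = .x ∨ w = .y → w ∉ v₂ := by
      intro w hw
      refine h.not_mem_right (d := w) (by rcases hw with rfl | rfl <;> simp) hu' hv hu₁ hu₂ hv₁ hv₂
        ?_ ?_
      · refine List.mem_append_left _ (List.count_pos_iff.1 ?_)
        have h₁ := hl.count_x
        have h₂ := hl.count_y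
        rcases hw with rfl | rfl <;> omega
      · rcases hw with rfl | rfl <;> simp [mem_tailWord, List.mem_replicate]
    refine ⟨h₁, h₂, fun q' hq' => ?_, fun q' hq' => ?_, fun q' hq' hT₁ => ?_, hxy _ (Or.inl rfl),
      hxy _ (Or.inr rfl)⟩
    · by_contra hn
      have hq'T : q' ∈ q₀ :: T := by rw [hq]; simp [hq']
      have hne : Var.t q ≠ .t q' := fun e => hqT₂ (by cases e; exact hq')
      have h₃ := htv q' hq'T
      rw [hv, List.count_append, List.count_cons, List.count_eq_zero_of_not_mem hn] at h₃
      refine h'.simple_order (d := .t q') hne hv hu' hv₁ hv₂ hu₁ hu₂ ?_ hn ?_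
      · simpa [hne] using h₃
      · exact List.mem_append_right _ (mem_tailWord.2 ⟨q', hq', Or.inl rfl⟩)
    · refine h.not_mem_right (d := .z q') (by simp) hu' hv hu₁ hu₂ hv₁ hv₂ ?_ ?_
      · exact List.mem_append_right _ (mem_tailWord.2 ⟨q', hq', Or.inr rfl⟩)
      · rw [List.mem_append, List.mem_replicate, mem_tailWord]
        rintro (⟨-, h⟩ | ⟨r, hr, h | h⟩)
        · cases h; exact hqT₁ hq'
        · cases h
        · cases h; exact hdisj q' hq' q' (by simp [hr]) rfl
    · subst hT₁
      refine (h.count_left_eq_one (d := .z q') (by simp) hu' hv hu₁ hu₂ hv₁ hv₂ ?_ ?_).1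
      · simpa [tailWord] using hl.count_z q' hq'
      · rw [hq, List.nil_append, List.mem_cons] at hq'
        rcases hq' with rfl | hq'
        · simp
        · exact List.mem_append_right _ (mem_tailWord.2 ⟨q', hq', Or.inr rfl⟩)
  have hq₀ : q₀ ∈ q₀ :: T := by simp
  obtain ⟨l', R, hv⟩ := List.append_of_mem
    (List.count_pos_iff.1 ((htv q₀ hq₀).symm ▸ Nat.one_pos))
  obtain ⟨-, -, h₃, -, h₅, hx, hy⟩ := hsplit [] q₀ T l' R rfl hv
  have hcount : ∀ q ∈ q₀ :: T, l'.count (.t q) = 0 ∧ (Var.t q₀ :: R).count (.t q) = 1 := by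
    intro q hq
    have h₆ := htv q hq
    have h₇ : .t q ∈ Var.t q₀ :: R := by
      rcases List.mem_cons.1 hq with rfl | hq
      · simp
      · exact List.mem_cons_of_mem _ (h₃ q hq)
    have h₈ := List.count_pos_iff.2 h₇
    rw [hv, List.count_append] at h₆
    omega
  have htail : IsTail (q₀ :: T) (.t q₀ :: R) := by
    refine ⟨fun w hw => ?_, fun q hq => (hcount q hq).2, fun T₁ q T₂ R₁ R₂ hq hR => ?_⟩
    · rcases hletters w (hmem w (by rw [hv]; exact List.mem_append_right _ hw)) with
        rfl | rfl | h
      · simp [hx] at hw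
      · simp [hy] at hw
      · exact h
    · obtain ⟨h₆, h₇, h₈, h₉, -⟩ := hsplit T₁ q T₂ (l' ++ R₁) R₂ hq (by rw [hv, hR]; simp)
      refine ⟨?_, h₇, h₈, h₉⟩
      rw [List.count_append, h₅ q (by rw [hq]; simp) rfl] at h₆
      exact List.count_eq_zero.1 (by omega)
  obtain ⟨f', hf'⟩ := htail.exists_eq_tailWord hT
  have htwo : ∀ w, w = .x ∨ w = .y → 2 ≤ l'.count w := by
    intro w hw
    have h₆ : w ∉ Var.t q₀ :: R := by rcases hw with rfl | rfl <;> simp [hx, hy]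
    have h₇ : v.count w = l'.count w := by
      rw [hv, List.count_append, List.count_eq_zero_of_not_mem h₆, add_zero]
    have h₈ : 2 ≤ u.count w := by
      rw [hu, List.count_append]
      have h₁ := hl.count_x
      have h₂ := hl.count_y
      rcases hw with rfl | rfl <;> omega
    have h₉ : v.count w ≠ 1 := fun e => by
      have := h'.count_eq_one e
      omega
    have h₁₀ : v.count w ≠ 0 := fun e => by
      have := List.count_eq_zero.2 (h'.not_mem (List.count_eq_zero.1 e))
      omega
    omega
  refine ⟨l', f', by rw [hv, hf'], ?_, fun q hq => h₅ q hq rfl, ?_, htwo _ (Or.inl rfl),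
    htwo _ (Or.inr rfl)⟩
  · intro q hq
    by_cases hqT : q ∈ q₀ :: T
    · exact List.count_eq_zero.1 (hcount q hqT).1 hq
    · rcases hletters _ (hmem _ (by rw [hv]; exact List.mem_append_left _ hq)) with
        e | e | ⟨r, hr, e | e⟩ <;> cases e
      exact hqT hr
  · intro w hw
    rcases hletters w (hmem w (by rw [hv]; exact List.mem_append_left _ hw)) with
        e | e | ⟨r, hr, rfl | e⟩
    · exact Or.inl e
    · exact Or.inr (Or.inl e)
    · exact absurd hw (List.count_eq_zero.1 (hcount r hr).1)
    · exact Or.inr (Or.inr ⟨r, hr, e⟩)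

end Saturation

/-! ### Reconstruction of the block -/

theorem pairwise_zIndices {l : List Var} (h : (zIndices l).Nodup) :
    (zIndices l).Pairwise fun i j => preCount (.z j) i l = 0 := by
  induction l with
  | nil => simp
  | cons v l ih =>
    have key : ∀ L : List ZIndex, (∀ q ∈ L, v ≠ .z q) →
        L.Pairwise (fun i j => preCount (.z j) i l = 0) →
        L.Pairwise fun i j => preCount (.z j) i (v :: l) = 0 := by
      intro L hL hp
      refine hp.imp_of_mem fun {i j} hi hj hij => ?_
      rw [preCount_cons_of_ne (hL i hi), hij, add_zero, List.count_singleton]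
      simpa using hL j hj
    cases v with
    | z q =>
      rw [zIndices_z, List.nodup_cons] at h
      rw [zIndices_z, List.pairwise_cons]
      refine ⟨fun j _ => preCount_cons_self _ _ _, key _ (fun r hr e => ?_) (ih h.2)⟩
      cases e
      exact h.1 hr
    | x => exact key _ (by simp) (ih h)
    | y => exact key _ (by simp) (ih h)
    | t q => exact key _ (by simp) (ih h)

theorem exists_split_z {l : List Var} {q : ZIndex} (h : .z q ∈ l) :
    ∃ a b, l = a ++ .z q :: b ∧ .z q ∉ a ∧ ∀ s, preCount s q l = a.count s := by
  obtain ⟨a, b, rfl, ha⟩ := List.eq_append_cons_of_mem h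
  refine ⟨a, b, rfl, ha, fun s => ?_⟩
  rw [preCount_append_of_not_mem ha, preCount_cons_self, add_zero]

theorem preCount_z_eq_zero_iff {l : List Var} {i j : ZIndex} (hij : i ≠ j) (hi : .z i ∈ l)
    (hj : .z j ∈ l) : preCount (.z j) i l = 0 ↔ preCount (.z i) j l ≠ 0 := by
  obtain ⟨a, b, rfl, ha, h⟩ := exists_split_z hj
  rw [h]
  constructor
  · intro h₀ h₁
    rw [List.count_eq_zero] at h₁
    rw [preCount_append_of_not_mem h₁, preCount_cons_of_ne (by simpa using hij.symm)] at h₀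
    simp at h₀
  · intro h₀
    have hia := List.count_pos_iff.1 (Nat.pos_of_ne_zero h₀)
    have h₁ := preCount_le_append (s := .z j) (.z j :: b) hia
    rw [List.count_eq_zero_of_not_mem ha] at h₁
    omega

section Order

variable {m : ℕ} {π : Equiv.Perm (Fin (m + 1))} {T : List ZIndex} {u v l l' : List Var}
  {f f' : ZIndex → ℕ}

theorem IsPreBlock.mem_z (hl : IsPreBlock T l) {q : ZIndex} (hq : q ∈ T) : .z q ∈ l :=
  List.count_pos_iff.1 (by rw [hl.count_z q hq]; exact Nat.one_pos)

/-- This is `Indist.not_mem_left` with separator t_j: z_j recurs to its right, but d must not. Hence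
the requirement that a letter d = z_i come from an index before j in the tail. -/
theorem Indist.preCount_eq_zero (h : Indist π u v) (hT : T.Nodup) (hl : IsPreBlock T l)
    (hl' : IsPreBlock T l') (hu : u = l ++ tailWord T f) (hv : v = l' ++ tailWord T f')
    {T₁ T₂ : List ZIndex} {j : ZIndex} (hj : T = T₁ ++ j :: T₂) {d : Var}
    (hd : d = .x ∨ d = .y ∨ ∃ i ∈ T₁, d = .z i) (h₀ : preCount d j l = 0) :
    preCount d j l' = 0 := by
  have hjT : j ∈ T := by rw [hj]; simp
  have hcu := hu ▸ count_t_preBlock hT hl f hjT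
  have hcv := hv ▸ count_t_preBlock hT hl' f' hjT
  have hdl : d ∈ l := by
    rcases hd with rfl | rfl | ⟨i, hi, rfl⟩
    · exact List.count_pos_iff.1 (by have := hl.count_x; omega)
    · exact List.count_pos_iff.1 (by have := hl.count_y; omega)
    · exact hl.mem_z (by rw [hj]; simp [hi])
  obtain ⟨a, b, hab, ha, hc⟩ := exists_split_z (hl.mem_z hjT)
  obtain ⟨a', b', hab', ha', hc'⟩ := exists_split_z (hl'.mem_z hjT)
  rw [hc, List.count_eq_zero] at h₀
  rw [hc', List.count_eq_zero]
  have hu' : u = a ++ .z j :: ((b ++ tailWord T₁ f) ++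
      .t j :: (List.replicate (f j + 1) (.z j) ++ tailWord T₂ f)) := by
    rw [hu, hab]; nth_rw 1 [hj]; rw [tailWord_split]; simp
  have hv' : v = a' ++ .z j :: ((b' ++ tailWord T₁ f') ++
      .t j :: (List.replicate (f' j + 1) (.z j) ++ tailWord T₂ f')) := by
    rw [hv, hab']; nth_rw 1 [hj]; rw [tailWord_split]; simp
  rw [hj, List.nodup_append, List.nodup_cons] at hT
  obtain ⟨-, ⟨hjT₂, -⟩, hdisj⟩ := hT
  have hjT₁ : j ∉ T₁ := fun h => hdisj j h j (by simp) rfl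
  have hjd : d ≠ .z j := by
    rcases hd with rfl | rfl | ⟨i, hi, rfl⟩
    · simp
    · simp
    · exact fun e => hjT₁ (by cases e; exact hi)
  refine h.not_mem_left (d := d) (q := .z j) (s := .t j) ?_ (by simp) hjd hu' hv' ?_ ?_ ?_ ha' ?_
  · rcases hd with rfl | rfl | ⟨i, hi, rfl⟩ <;> simp
  · rw [hu'] at hcu
    refine ⟨?_, ?_, ?_⟩ <;> rw [← List.count_eq_zero] <;>
      simp only [List.count_append, List.count_cons, beq_self_eq_true, if_true] at hcu ⊢ <;> omega
  · rw [hv'] at hcv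
    refine ⟨?_, ?_, ?_⟩ <;> rw [← List.count_eq_zero] <;>
      simp only [List.count_append, List.count_cons, beq_self_eq_true, if_true] at hcv ⊢ <;> omega
  · refine ⟨ha, ?_, by simp⟩
    rw [List.mem_append, mem_tailWord]
    rintro (hb | ⟨r, hr, e | e⟩)
    · have := hl.count_z j hjT
      rw [hab, List.count_append, List.count_cons_self] at this
      have := List.count_pos_iff.2 hb
      omega
    · cases e
    · cases e; exact hjT₁ hr
  · refine ⟨h₀, ?_, ?_⟩
    · rw [hab, List.mem_append, List.mem_cons] at hdl
      exact List.mem_append_left _ ((hdl.resolve_left h₀).resolve_left hjd)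
    · rw [List.mem_append, List.mem_replicate, mem_tailWord]
      rcases hd with rfl | rfl | ⟨i, hi, rfl⟩
      · simp
      · simp
      · rintro (⟨-, e⟩ | ⟨r, hr, e | e⟩)
        · exact hjd e
        · cases e
        · cases e; exact hdisj i hi i (by simp [hr]) rfl

/-- For every pair of indices, the one later in `T` can play the role of j in
`Indist.preCount_eq_zero`. As the z's of the block are linearly ordered, this one direction decides
their relative order. -/
theorem Indist.zIndices_eq (h : Indist π u v) (h' : Indist π v u) (hT : T.Nodup)
    (hl : IsPreBlock T l) (hl' : IsPreBlock T l') (hu : u = l ++ tailWord T f)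
    (hv : v = l' ++ tailWord T f') : zIndices l = zIndices l' := by
  have hz : ∀ {l : List Var}, IsPreBlock T l → (zIndices l).Perm T := by
    intro l hl
    refine List.perm_iff_count.2 fun q => ?_
    rw [count_zIndices]
    by_cases hq : q ∈ T
    · rw [hl.count_z q hq, List.count_eq_one_of_mem hT hq]
    · rw [List.count_eq_zero_of_not_mem hq, List.count_eq_zero]
      intro hql
      rcases hl.mem _ hql with e | e | ⟨r, hr, e⟩ <;> cases e
      exact hq hr
  have hiff : ∀ {i j : ZIndex}, i ∈ T → j ∈ T → i ≠ j →
      (preCount (.z j) i l = 0 ↔ preCount (.z j) i l' = 0) := by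
    intro i j hi hj hij
    obtain ⟨T₁, T₂, hT₁⟩ := List.append_of_mem hi
    by_cases hjT : j ∈ T₁
    · have hd : Var.z j = .x ∨ Var.z j = .y ∨ ∃ r ∈ T₁, Var.z j = .z r :=
        Or.inr (Or.inr ⟨j, hjT, rfl⟩)
      exact ⟨h.preCount_eq_zero hT hl hl' hu hv hT₁ hd, h'.preCount_eq_zero hT hl' hl hv hu hT₁ hd⟩
    · have hjT₂ : j ∈ T₂ := by
        rw [hT₁, List.mem_append, List.mem_cons] at hj
        exact (hj.resolve_left hjT).resolve_left hij.symm
      obtain ⟨T₃, T₄, rfl⟩ := List.append_of_mem hjT₂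
      have hT₂ : T = (T₁ ++ i :: T₃) ++ j :: T₄ := by rw [hT₁]; simp
      have hd : Var.z i = .x ∨ Var.z i = .y ∨ ∃ r ∈ T₁ ++ i :: T₃, Var.z i = .z r :=
        Or.inr (Or.inr ⟨i, by simp, rfl⟩)
      rw [preCount_z_eq_zero_iff hij (hl.mem_z hi) (hl.mem_z hj),
        preCount_z_eq_zero_iff hij (hl'.mem_z hi) (hl'.mem_z hj)]
      exact not_congr ⟨h.preCount_eq_zero hT hl hl' hu hv hT₂ hd,
        h'.preCount_eq_zero hT hl' hl hv hu hT₂ hd⟩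
  have hp₁ := pairwise_zIndices ((hz hl).nodup_iff.2 hT)
  have hp₂ := pairwise_zIndices ((hz hl').nodup_iff.2 hT)
  refine List.Perm.eq_of_pairwise (le := fun i j => i ≠ j ∧ preCount (.z j) i l = 0) ?_ ?_ ?_
    ((hz hl).trans (hz hl').symm)
  · intro i j hi hj hij hji
    have hi := hl.mem_z ((hz hl).mem_iff.1 hi)
    have hj := hl'.mem_z ((hz hl').mem_iff.1 hj)
    exact absurd hji.2 ((preCount_z_eq_zero_iff hij.1 hi
      (hl.mem_z ((hz hl').mem_iff.1 (mem_zIndices.2 hj)))).1 hij.2)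
  · exact List.Pairwise.and ((hz hl).nodup_iff.2 hT) hp₁
  · exact (List.Pairwise.and ((hz hl').nodup_iff.2 hT) hp₂).imp_of_mem
      fun {i j} hi hj hij => ⟨hij.1, (hiff ((hz hl').mem_iff.1 hi) ((hz hl').mem_iff.1 hj) hij.1).2
        hij.2⟩

end Order

theorem IsBlock.isPreBlock {P T : List ZIndex} {l : List Var} (hP : (zOrder P).Nodup)
    (hPT : ∀ q, q ∈ zOrder P ↔ q ∈ T) (hl : IsBlock P l) : IsPreBlock T l where
  not_t := hl.not_t
  count_z q hq := by
    rw [← count_zIndices, hl.zs, List.count_eq_one_of_mem hP ((hPT q).2 hq)]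
  mem v hv := by
    cases v with
    | x => simp
    | y => simp
    | z q =>
      rw [← mem_zIndices, hl.zs, hPT] at hv
      exact Or.inr (Or.inr ⟨q, hv, rfl⟩)
    | t q => exact absurd hv (hl.not_t q)
  count_x := hl.count_x
  count_y := hl.count_y

theorem Indist.exists_block {m : ℕ} {π : Equiv.Perm (Fin (m + 1))} {P τ : List ZIndex}
    {q₀ : ZIndex} (hP : (zOrder P).Nodup) (hT : (q₀ :: τ).Nodup)
    (hPT : ∀ q, q ∈ zOrder P ↔ q ∈ q₀ :: τ) {u v l : List Var} {f : ZIndex → ℕ}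
    (h : Indist π u v) (h' : Indist π v u) (hl : IsBlock P l)
    (hu : u = l ++ tailWord (q₀ :: τ) f) :
    ∃ l' f', v = l' ++ tailWord (q₀ :: τ) f' ∧ IsBlock P l' := by
  have hpl := hl.isPreBlock hP hPT
  obtain ⟨l', f', hv, hpl'⟩ := h.exists_preBlock hT h' hpl hu
  have hiff : ∀ q ∈ q₀ :: τ, ∀ d, d = .x ∨ d = .y → (preCount d q l = 0 ↔ preCount d q l' = 0) := by
    intro q hq d hd
    obtain ⟨T₁, T₂, hT₁⟩ := List.append_of_mem hq
    have hd : d = .x ∨ d = .y ∨ ∃ i ∈ T₁, d = .z i := by tauto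
    exact ⟨h.preCount_eq_zero hT hpl hpl' hu hv hT₁ hd,
      h'.preCount_eq_zero hT hpl' hpl hv hu hT₁ hd⟩
  have ha : .a ∈ q₀ :: τ := (hPT _).1 (by simp [zOrder])
  have hb : .b ∈ q₀ :: τ := (hPT _).1 (by simp [zOrder])
  have h₁ := hl.x_a
  have h₂ := hl.y_b
  have h₃ := hiff _ ha .x (Or.inl rfl)
  have h₄ := hiff _ hb .y (Or.inr rfl)
  exact ⟨l', f', hv, hpl'.not_t, by rw [← h.zIndices_eq h' hT hpl hpl' hu hv, hl.zs], hpl'.count_x,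
    hpl'.count_y, by omega, (hiff _ ha .y (Or.inr rfl)).1 hl.y_a, by omega⟩

/-! ### The order of the letters attached to a permutation -/

section HatOrder

variable {m : ℕ} (π : Equiv.Perm (Fin (m + 1)))

def hatOrder : List ZIndex := List.ofFn fun i : Fin m => ZIndex.p (π i.castSucc)

/-- The three indices d, c, e share the place of the last inner z, so that deleting any two of them
recovers the tail of â. -/
def hatGroup (i : ℕ) : List ZIndex := if i = lastIndex π then [.d, .c, .e] else [.p i]

def hatTailOrder : List ZIndex := .a :: (List.range (m + 1)).flatMap (hatGroup π)

theorem mem_hatOrder {q : ZIndex} :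
    q ∈ hatOrder π ↔ ∃ i < m + 1, i ≠ lastIndex π ∧ q = .p i := by
  simp only [hatOrder, List.mem_ofFn]
  constructor
  · rintro ⟨i, rfl⟩
    refine ⟨_, (π i.castSucc).isLt, fun h => ?_, rfl⟩
    exact absurd (π.injective (Fin.ext h)) (Fin.castSucc_lt_last i).ne
  · rintro ⟨i, hi, hne, rfl⟩
    obtain ⟨j, hj⟩ := π.surjective ⟨i, hi⟩
    have hjl : j ≠ Fin.last m := by
      rintro rfl
      exact hne (by rw [lastIndex, hj])
    refine ⟨j.castPred hjl, ?_⟩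
    rw [Fin.castSucc_castPred, hj]

theorem nodup_zOrder : (zOrder (hatOrder π)).Nodup := by
  have h₁ : (hatOrder π).Nodup := by
    refine List.nodup_ofFn.2 fun i j h => ?_
    simp only [ZIndex.p.injEq, Fin.val_inj, EmbeddingLike.apply_eq_iff_eq,
      Fin.castSucc_inj] at h
    exact h
  simp only [zOrder, List.nodup_cons, List.nodup_append, List.mem_cons, List.mem_append, h₁,
    mem_hatOrder]
  simp
  rintro q i - - rfl
  simp

theorem mem_hatGroups {q : ZIndex} : q ∈ (List.range (m + 1)).flatMap (hatGroup π) ↔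
    q = .d ∨ q = .c ∨ q = .e ∨ q ∈ hatOrder π := by
  simp only [List.mem_flatMap, List.mem_range, hatGroup, mem_hatOrder]
  constructor
  · rintro ⟨i, hi, h⟩
    split_ifs at h with h'
    · simp only [List.mem_cons, List.not_mem_nil, or_false] at h
      tauto
    · exact Or.inr (Or.inr (Or.inr ⟨i, hi, h', by simpa using h⟩))
  · have hlast : lastIndex π < m + 1 := (π (Fin.last m)).isLt
    rintro (rfl | rfl | rfl | ⟨i, hi, hne, rfl⟩)
    · exact ⟨_, hlast, by simp⟩
    · exact ⟨_, hlast, by simp⟩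
    · exact ⟨_, hlast, by simp⟩
    · exact ⟨i, hi, by simp [hne]⟩

theorem mem_zOrder_iff (q : ZIndex) :
    q ∈ zOrder (hatOrder π) ↔ q ∈ ZIndex.b :: hatTailOrder π := by
  simp only [zOrder, hatTailOrder, List.mem_cons, List.mem_append, mem_hatGroups, List.not_mem_nil]
  tauto

theorem nodup_hatTailOrder : (ZIndex.b :: hatTailOrder π).Nodup := by
  have h₁ : ((List.range (m + 1)).flatMap (hatGroup π)).Nodup := by
    refine List.nodup_flatMap.2 ⟨fun i _ => ?_, ?_⟩
    · unfold hatGroup; split_ifs <;> simp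
    · refine List.nodup_range.imp fun {i j} hij => ?_
      intro q hi hj
      unfold hatGroup at hi hj
      split_ifs at hi hj with h h' h' <;> simp at hi hj
      · exact hij (h.trans h'.symm)
      · subst hj; simp at hi
      · subst hi; simp at hj
      · subst hi; simp at hj; exact hij hj
  simp only [hatTailOrder, List.nodup_cons, h₁, List.mem_cons, mem_hatGroups, mem_hatOrder]
  simp

end HatOrder

/-! ### Occurrences before the last letters -/

section Test

variable {m : ℕ} (π : Equiv.Perm (Fin (m + 1)))

/-- The substitution that maps `s` to `x` and `r` to the last letter between the occurrences of
`x`, and deletes the letters outside of the permuted sequence. -/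
def lastSubst (s : Var) (r : ZIndex) : Var → List Letter
  | .z (.p i) => [.z i]
  | .t (.p i) => [.t i]
  | .z q => if q = r then [.z (lastIndex π)] else []
  | .t q => if q = r then [.t (lastIndex π)] else []
  | v => if v = s then [.x] else []

theorem flatMap_eq_zIndices {φ : Var → List Letter} {w : List Var}
    (h : ∀ v ∈ w, (∃ q, v = .z q) ∨ φ v = []) :
    w.flatMap φ = (zIndices w).flatMap fun q => φ (.z q) := by
  induction w with
  | nil => simp
  | cons v w ih =>
    have ih := ih fun v hv => h v (List.mem_cons_of_mem _ hv)
    have hv := h v List.mem_cons_self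
    cases v <;> simp_all

variable {s : Var} {r : ZIndex}

theorem lastSubst_self (hs : s = .x ∨ s = .y) (r : ZIndex) : lastSubst π s r s = [.x] := by
  rcases hs with rfl | rfl <;> simp [lastSubst]

theorem lastSubst_z_last (hr : r = .d ∨ r = .c ∨ r = .e) :
    lastSubst π s r (.z r) = [.z (lastIndex π)] := by
  rcases hr with rfl | rfl | rfl <;> simp [lastSubst]

theorem flatMap_hatOrder_lastSubst :
    (hatOrder π).flatMap (fun q => lastSubst π s r (.z q)) = hatInit π := by
  simp only [hatOrder, hatInit, List.ofFn_eq_map, List.flatMap_map, lastSubst]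
  induction List.finRange m <;> simp_all

theorem flatMap_tailWord_lastSubst (hr : r = .d ∨ r = .c ∨ r = .e)
    (f : ZIndex → ℕ) :
    (tailWord (.b :: hatTailOrder π) f).flatMap (lastSubst π s r) =
      hatTail (m + 1) fun i => if i = lastIndex π then f r else f (.p i) := by
  have hrep : ∀ n q, (List.replicate n (Var.z q)).flatMap (lastSubst π s r) =
      (List.replicate n (lastSubst π s r (.z q))).flatten := by
    intro n q
    rw [List.flatMap_def, List.map_replicate]
  have hone : ∀ (n : ℕ) (a : Letter), (List.replicate n [a]).flatten = List.replicate n a := by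
    intro n a
    induction n <;> simp_all [List.replicate_succ]
  have hnil : ∀ n : ℕ, (List.replicate n ([] : List Letter)).flatten = [] := by
    intro n; simp
  have h : ∀ i, (tailWord (hatGroup π i) f).flatMap (lastSubst π s r) =
      .t i :: List.replicate ((if i = lastIndex π then f r else f (.p i)) + 1) (.z i) := by
    intro i
    unfold hatGroup
    split_ifs with hi
    · subst hi
      rcases hr with rfl | rfl | rfl <;>
        simp [tailWord, hrep, lastSubst, hone]
    · simp [tailWord, hrep, lastSubst, hone]
  rw [hatTailOrder, tailWord_cons, tailWord_cons]
  have h₂ : ∀ L : List ℕ, (tailWord (L.flatMap (hatGroup π)) f).flatMap (lastSubst π s r) =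
      L.flatMap fun i => .t i ::
        List.replicate ((if i = lastIndex π then f r else f (.p i)) + 1) (.z i) := by
    intro L
    induction L with
    | nil => simp [tailWord]
    | cons i L ih =>
      rw [List.flatMap_cons, List.flatMap_cons, ← h i, ← ih]
      simp [tailWord]
  simp only [List.flatMap_cons, List.flatMap_append, hrep, h₂]
  rcases hr with rfl | rfl | rfl <;> simp [lastSubst, hatTail]

theorem count_x_flatMap_lastSubst (hs : s = .x ∨ s = .y) (w : List Var) :
    (w.flatMap (lastSubst π s r)).count .x = w.count s := by
  induction w with
  | nil => simp
  | cons v w ih =>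
    rw [List.flatMap_cons, List.count_append, ih, List.count_cons, add_comm]
    congr 1
    rcases v with _ | _ | q | q
    · rcases hs with rfl | rfl <;> simp [lastSubst]
    · rcases hs with rfl | rfl <;> simp [lastSubst]
    all_goals
      cases q <;> rcases hs with rfl | rfl <;> simp [lastSubst] <;> split_ifs <;> simp

theorem z_last_not_mem_flatMap_lastSubst {w : List Var} (h₁ : .z r ∉ w)
    (h₂ : ∀ q ∈ zIndices w, q ∈ zOrder (hatOrder π)) (h₃ : ∀ q, .t q ∉ w) :
    .z (lastIndex π) ∉ w.flatMap (lastSubst π s r) := by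
  rw [List.mem_flatMap]
  rintro ⟨v, hv, h⟩
  rcases v with _ | _ | q | q
  · simp only [lastSubst] at h; split_ifs at h <;> simp at h
  · simp only [lastSubst] at h; split_ifs at h <;> simp at h
  · have hq := h₂ q (mem_zIndices.2 hv)
    cases q with
    | p i =>
      simp only [lastSubst, List.mem_singleton, Letter.z.injEq] at h
      simp only [zOrder, List.mem_cons, List.mem_append, mem_hatOrder] at hq
      simp at hq
      exact hq.2 h.symm
    | _ =>
      simp only [lastSubst] at h
      split_ifs at h with e
      · exact h₁ (e ▸ hv)
      · simp at h
  · exact h₃ q hv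

/-- The only s before z_r already precedes z_b, hence all letters indexed by `hatOrder π`. So the
image begins x z ⋯ z, and the remaining s's form a nonempty run after the last z. -/
theorem flatMap_block_lastSubst (hs : s = .x ∨ s = .y)
    (hr : r = .d ∨ r = .c ∨ r = .e) {l : List Var} (hl : IsBlock (hatOrder π) l)
    (hb : 1 ≤ preCount s .b l) (h₁ : preCount s r l = 1) :
    ∃ n, l.flatMap (lastSubst π s r) =
      .x :: (hatInit π ++ .z (lastIndex π) :: List.replicate (n + 1) .x) := by
  have hP := nodup_zOrder π
  have hself := lastSubst_self π hs r
  have hsub : ∃ r₁ r₂, zOrder (hatOrder π) = .a :: .b :: (hatOrder π ++ r₁) ++ r :: r₂ ∧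
      ∀ q ∈ r₁ ++ r₂, lastSubst π s r (.z q) = [] := by
    rcases hr with rfl | rfl | rfl
    · exact ⟨[], [.c, .e], by simp [zOrder], by simp [lastSubst]⟩
    · exact ⟨[.d], [.e], by simp [zOrder], by simp [lastSubst]⟩
    · exact ⟨[.d, .c], [], by simp [zOrder], by simp [lastSubst]⟩
  obtain ⟨r₁, r₂, hzr, hkill⟩ := hsub
  have hmem : ∀ q ∈ zOrder (hatOrder π), Var.z q ∈ l := fun q hq => by
    rw [← mem_zIndices, hl.zs]; exact hq
  obtain ⟨a, k, rfl, hra, hca⟩ := exists_split_z (hmem r (by rw [hzr]; simp))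
  obtain ⟨hza, hzk⟩ := hl.zIndices_prefix hP hzr
  obtain ⟨a₀, a₁, rfl, hba, hcb⟩ := exists_split_z (l := a) (q := .b)
    (by rw [← mem_zIndices, hza]; simp)
  have hl' := hl
  rw [List.append_assoc, List.cons_append] at hl'
  obtain ⟨hz₀, hz₁⟩ := hl'.zIndices_prefix hP (r₁ := [.a]) (r₂ := hatOrder π ++ [.d, .c, .e]) rfl
  rw [zIndices_append, zIndices_z, hz₀] at hza
  rw [hca] at h₁
  rw [preCount_append_of_mem (by simp), hcb] at hb
  have hsb : s ≠ .z .b := by rcases hs with rfl | rfl <;> simp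
  have hsr : s ≠ .z r := by rcases hs with rfl | rfl <;> simp
  rw [List.count_append, List.count_cons_of_ne hsb.symm] at h₁
  have hkill' : ∀ v, v ≠ s → (∀ q, v ≠ .z q) → (∀ q, v ≠ .t q) → lastSubst π s r v = [] := by
    intro v h₁ h₂ h₃
    rcases v with _ | _ | q | q
    · simpa [lastSubst] using h₁
    · simpa [lastSubst] using h₁
    · exact absurd rfl (h₂ q)
    · exact absurd rfl (h₃ q)
  have hnt := hl.not_t
  have hf₀ : a₀.flatMap (lastSubst π s r) = [.x] := by
    rw [flatMap_eq_replicate hself]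
    · rw [show a₀.count s = 1 by omega]; rfl
    · intro v hv
      by_cases hvs : v = s
      · exact Or.inl hvs
      by_cases hvz : ∃ q, v = .z q
      · obtain ⟨q, rfl⟩ := hvz
        rw [← mem_zIndices, hz₀, List.mem_singleton] at hv
        subst hv
        right
        rcases hr with rfl | rfl | rfl <;> simp [lastSubst]
      · exact Or.inr (hkill' v hvs (fun q e => hvz ⟨q, e⟩) fun q e => hnt q (by simp [← e, hv]))
  have hf₁ : a₁.flatMap (lastSubst π s r) = hatInit π := by
    have hz₁' : zIndices a₁ = hatOrder π ++ r₁ := by simpa using hza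
    rw [flatMap_eq_zIndices, hz₁', List.flatMap_append, flatMap_hatOrder_lastSubst π,
      List.flatMap_eq_nil_iff.2 fun q hq => hkill q (List.mem_append_left _ hq), List.append_nil]
    intro v hv
    by_cases hvz : ∃ q, v = .z q
    · exact Or.inl hvz
    · refine Or.inr (hkill' v (fun e => ?_) (fun q e => hvz ⟨q, e⟩)
        fun q e => hnt q (by simp [← e, hv]))
      have := List.count_pos_iff.2 (e ▸ hv)
      omega
  have hfk : k.flatMap (lastSubst π s r) = List.replicate (k.count s) .x := by
    refine flatMap_eq_replicate hself fun v hv => ?_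
    by_cases hvs : v = s
    · exact Or.inl hvs
    by_cases hvz : ∃ q, v = .z q
    · obtain ⟨q, rfl⟩ := hvz
      rw [← mem_zIndices, hzk] at hv
      exact Or.inr (hkill q (List.mem_append_right _ hv))
    · exact Or.inr (hkill' v hvs (fun q e => hvz ⟨q, e⟩) fun q e => hnt q (by simp [← e, hv]))
  have hk : 1 ≤ k.count s := by
    have h₂ : 2 ≤ ((a₀ ++ .z .b :: a₁) ++ .z r :: k).count s := by
      rcases hs with rfl | rfl
      · exact hl.count_x
      · exact hl.count_y
    rw [List.count_append, List.count_cons_of_ne hsr.symm, List.count_append,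
      List.count_cons_of_ne hsb.symm] at h₂
    omega
  refine ⟨k.count s - 1, ?_⟩
  have hb₀ : lastSubst π s r (.z .b) = [] := by rcases hr with rfl | rfl | rfl <;> simp [lastSubst]
  rw [Nat.sub_add_cancel hk]
  simp [hf₀, hf₁, hfk, hb₀, lastSubst_z_last π hr]

variable {π} in
-- The place where the permutation is used: under `lastSubst` the word becomes â up to exponents, so
-- exactly one x precedes the first copy of its last inner z, and this property passes to `v`.
theorem Indist.preCount_eq_one (hs : s = .x ∨ s = .y)
    (hr : r = .d ∨ r = .c ∨ r = .e) {u v l l' : List Var} {f f' : ZIndex → ℕ}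
    (h : Indist π u v) (hl : IsBlock (hatOrder π) l) (hl' : IsBlock (hatOrder π) l')
    (hu : u = l ++ tailWord (.b :: hatTailOrder π) f)
    (hv : v = l' ++ tailWord (.b :: hatTailOrder π) f')
    (hb : 1 ≤ preCount s .b l) (h₁ : preCount s r l = 1) : preCount s r l' = 1 := by
  obtain ⟨n, hn⟩ := flatMap_block_lastSubst π hs hr hl hb h₁
  have h₂ := h (lastSubst π s r) [] []
  rw [hu, hv, List.flatMap_append, hn, flatMap_tailWord_lastSubst π hr] at h₂
  have h₃ := count_takeWhile_of_lambdaRel π (h₂ (by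
    simpa using lambdaRel_hatWord π n fun i => if i = lastIndex π then f r else f (.p i)))
  obtain ⟨a, k, rfl, hra, hca⟩ := exists_split_z (l := l') (q := r) (by
    rw [← mem_zIndices, hl'.zs, zOrder]
    rcases hr with rfl | rfl | rfl <;> simp)
  have h₄ : .z (lastIndex π) ∉ a.flatMap (lastSubst π s r) := by
    refine z_last_not_mem_flatMap_lastSubst π hra (fun q hq => ?_)
      fun q hq => hl'.not_t q (by simp [hq])
    rw [← hl'.zs, zIndices_append]
    exact List.mem_append_left _ hq
  rw [hca, ← count_x_flatMap_lastSubst π hs a]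
  rw [List.nil_append, List.append_nil, List.flatMap_append, List.flatMap_append,
    List.flatMap_cons, lastSubst_z_last π hr, List.append_assoc, List.append_assoc,
    List.takeWhile_append_of_pos] at h₃
  · simpa using h₃
  · intro w hw
    simpa using fun e : w = .z (lastIndex π) => h₄ (e ▸ hw)

end Test

/-! ### Languages that are unions of classes -/

theorem IsBlock.one_le_preCount_x {P : List ZIndex} {l : List Var} (hl : IsBlock P l)
    {q : ZIndex} (hq : q ∈ zOrder P) (hqa : q ≠ .a) : 1 ≤ preCount .x q l := by
  obtain ⟨a, k, rfl, -, hc⟩ := exists_split_z (l := l) (q := q) (by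
    rw [← mem_zIndices, hl.zs]; exact hq)
  rw [hc]
  have ha : Var.z .a ∈ a := by
    by_contra ha
    have hz := hl.zs
    rw [zIndices_append, hl.zIndices_eq_nil ha, zIndices_z, zOrder] at hz
    exact hqa (List.cons.inj hz).1
  exact hl.x_a.trans (preCount_le_append _ ha)

section Final

variable {m : ℕ} {π : Equiv.Perm (Fin (m + 1))} {u v : List Var}

theorem Indist.blockLang_yCond (h : Indist π u v) (h' : Indist π v u)
    (hu : BlockLang (hatOrder π) (.b :: hatTailOrder π) YCond u) :
    BlockLang (hatOrder π) (.b :: hatTailOrder π) YCond v := by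
  obtain ⟨l, f, hu, hl, hY⟩ := hu
  obtain ⟨l', f', hv, hl'⟩ := h.exists_block (nodup_zOrder π) (nodup_hatTailOrder π)
    (mem_zOrder_iff π) h' hl hu
  exact ⟨l', f', hv, hl', h.preCount_eq_one (Or.inr rfl) (by simp) hl hl' hu hv hl.y_b hY⟩

theorem Indist.blockLang_xCond (h : Indist π u v) (h' : Indist π v u)
    (hu : BlockLang (hatOrder π) (.b :: hatTailOrder π) XCond u) :
    BlockLang (hatOrder π) (.b :: hatTailOrder π) XCond v := by
  obtain ⟨l, f, hu, hl, hd, hc⟩ := hu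
  obtain ⟨l', f', hv, hl'⟩ := h.exists_block (nodup_zOrder π) (nodup_hatTailOrder π)
    (mem_zOrder_iff π) h' hl hu
  refine ⟨l', f', hv, hl', h.preCount_eq_one (Or.inl rfl) (by simp) hl hl' hu hv
    (hl.one_le_preCount_x (by simp [zOrder]) (by simp)) hd, ?_⟩
  have h₁ := hl'.one_le_preCount_x (q := .c) (by simp [zOrder]) (by simp)
  -- At least one x precedes z_c in any block, so "at least two" means "not exactly one", and the
  -- reverse indistinguishability transfers this.
  have h₂ : preCount .x .c l' ≠ 1 := fun e => by
    have := h'.preCount_eq_one (Or.inl rfl) (by simp) hl' hl hv hu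
      (hl'.one_le_preCount_x (by simp [zOrder]) (by simp)) e
    omega
  omega

theorem toList_lift {X Y : Type} (φ : X → List Y) (w : FreeMonoid X) :
    (FreeMonoid.lift (fun v => FreeMonoid.ofList (φ v)) w).toList = w.toList.flatMap φ := by
  induction w using FreeMonoid.recOn with
  | one => simp
  | of_mul a w ih => simp [ih]

/-- If the image of `u` is a factor of the class of â, it lies outside the collapsed ideal, so
equality in the Rees quotient is `λ`-equivalence. -/
theorem indist_of_forall_hom (h : ∀ f : FreeMonoid Var →* QuotMonoid (lambdaCon Letter)
    {(hatA (m + 1) π : (lambdaCon Letter).Quotient)},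
    f (FreeMonoid.ofList u) = f (FreeMonoid.ofList v)) : Indist π u v := by
  intro φ p s hp
  have h₁ := h ((Con.mk' _).comp ((Con.mk' (lambdaCon Letter)).comp
    (FreeMonoid.lift fun v => FreeMonoid.ofList (φ v))))
  simp only [MonoidHom.comp_apply, Con.coe_mk'] at h₁
  rw [Con.eq] at h₁
  have h₂ : LambdaRel (u.flatMap φ) (v.flatMap φ) := by
    rcases h₁ with h₁ | ⟨h₁, -⟩
    · rw [Con.eq] at h₁
      have h₂ : LambdaRel _ _ := h₁
      rw [toList_lift, toList_lift] at h₂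
      exact h₂
    · refine absurd ⟨_, rfl, ((FreeMonoid.ofList p : FreeMonoid Letter) :
        (lambdaCon Letter).Quotient), ((FreeMonoid.ofList s : FreeMonoid Letter) :
        (lambdaCon Letter).Quotient), ?_⟩ h₁
      rw [← Con.coe_mul, ← Con.coe_mul, Con.eq]
      refine LambdaRel.symm (v := (hatA (m + 1) π).toList) ?_
      rw [FreeMonoid.toList_mul, FreeMonoid.toList_mul, toList_lift, toList_hatA]
      simpa using hp
  exact ((LambdaRel.rfl (u := p)).append (h₂.symm.append (LambdaRel.rfl (u := s)))).trans hp

theorem syntacticCon_mem_generatedBy {L : List Var → Prop}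
    (hL : ∀ u v, Indist π u v → Indist π v u → L u → L v) :
    (MonoidVariety.generatedBy (QuotMonoid (lambdaCon Letter)
      {(hatA (m + 1) π : (lambdaCon Letter).Quotient)})).Mem (syntacticCon L).Quotient := by
  refine MonoidVariety.mem_quotient (ι := FreeMonoid Var →* QuotMonoid (lambdaCon Letter)
    {(hatA (m + 1) π : (lambdaCon Letter).Quotient)}) _ (fun _ => _)
    (fun _ => MonoidVariety.mem_generatedBy _) (fun f => f) _ ?_
  intro u v huv p s
  have key : ∀ u v : FreeMonoid Var, (∀ f : FreeMonoid Var →* QuotMonoid (lambdaCon Letter)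
      {(hatA (m + 1) π : (lambdaCon Letter).Quotient)}, f u = f v) →
      Indist π (p ++ u.toList ++ s) (p ++ v.toList ++ s) := by
    intro u v huv
    refine indist_of_forall_hom fun f => ?_
    simp only [FreeMonoid.ofList_append, FreeMonoid.ofList_toList, map_mul, huv]
  have h₁ := key u v huv
  have h₂ := key v u fun f => (huv f).symm
  exact ⟨hL _ _ h₁ h₂, hL _ _ h₂ h₁⟩

end Final

/-! ### Intersection of the languages and failure of distributivity -/

theorem syntacticCon_and_mem {V : MonoidVariety} {L₁ L₂ : List Var → Prop}
    (h₁ : V.Mem (syntacticCon L₁).Quotient) (h₂ : V.Mem (syntacticCon L₂).Quotient) :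
    V.Mem (syntacticCon fun w => L₁ w ∧ L₂ w).Quotient := by
  refine MonoidVariety.mem_quotient (ι := Bool) V
    (fun i => (syntacticCon (if i then L₁ else L₂)).Quotient)
    (fun i => by cases i <;> assumption) (fun i => Con.mk' _) _ ?_
  intro u v h p s
  have h₃ := (Con.eq _).1 (h true) p s
  have h₄ := (Con.eq _).1 (h false) p s
  exact and_congr h₃ h₄

/-- The block is recovered as the part before t_q, which occurs exactly once. Hence the condition on
the block is a property of the word. -/
theorem blockLang_append_tailWord_iff {P τ : List ZIndex} {q : ZIndex} (hτ : (q :: τ).Nodup)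
    {C : List Var → Prop} {l : List Var} (hl : .t q ∉ l) (f : ZIndex → ℕ) :
    BlockLang P (q :: τ) C (l ++ tailWord (q :: τ) f) ↔ IsBlock P l ∧ C l := by
  constructor
  · rintro ⟨l', f', hw, h⟩
    rw [tailWord_cons, tailWord_cons] at hw
    obtain ⟨rfl, -⟩ := (List.append_cons_inj_of_notMem hl (by
      simp [mem_tailWord, (List.nodup_cons.1 hτ).1])).1 hw
    exact h
  · rintro h
    exact ⟨l, f, rfl, h⟩

theorem blockLang_and_iff {P τ : List ZIndex} {q : ZIndex} (hτ : (q :: τ).Nodup)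
    {C D : List Var → Prop} {w : List Var} :
    BlockLang P (q :: τ) C w ∧ BlockLang P (q :: τ) D w ↔
      BlockLang P (q :: τ) (fun l => C l ∧ D l) w := by
  constructor
  · rintro ⟨⟨l, f, rfl, hl, hC⟩, hD⟩
    exact ⟨l, f, rfl, hl, hC, ((blockLang_append_tailWord_iff hτ (hl.not_t q) f).1 hD).2⟩
  · rintro ⟨l, f, hw, hl, hC, hD⟩
    exact ⟨⟨l, f, hw, hl, hC⟩, ⟨l, f, hw, hl, hD⟩⟩

theorem not_mem_blockHead {P : List ZIndex} (hP : (zOrder P).Nodup) {q : ZIndex}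
    (hq : q ∈ [ZIndex.d, .c, .e]) : Var.z q ∉ blockHead P := by
  intro h
  have hqP : q ∈ .a :: .b :: P := by simpa [blockHead] using h
  have : (ZIndex.a :: ZIndex.b :: P ++ [ZIndex.d, .c, .e]).Nodup := hP
  exact (List.nodup_append.1 this).2.2 q hqP q hq rfl

theorem preCount_blockHead_append {P : List ZIndex} (hP : (zOrder P).Nodup) {q : ZIndex}
    (hq : q ∈ [ZIndex.d, .c, .e]) {s : Var} (hs : s = .x ∨ s = .y) (H : List Var) :
    preCount s q (blockHead P ++ H) = 1 + preCount s q H := by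
  rw [preCount_append_of_not_mem (not_mem_blockHead hP hq)]
  congr 1
  rcases hs with rfl | rfl <;> simp [blockHead, List.count_eq_zero]

theorem not_t_mem_blockHead_append {P : List ZIndex} {H : List Var} (hH : ∀ q, Var.t q ∉ H)
    (q : ZIndex) : .t q ∉ blockHead P ++ H := by
  simp [blockHead, hH]

theorem blockLang_interleavedWord {P τ : List ZIndex} (hP : (zOrder P).Nodup)
    (hτ : (ZIndex.b :: τ).Nodup) :
    BlockLang P (.b :: τ) (fun l => YCond l ∧ XCond l)
      (interleavedWord P τ [.z .d, .x, .z .c, .z .e, .y]) := by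
  have ht := not_t_mem_blockHead_append (P := P) (H := [.z .d, .x, .z .c, .z .e, .y]) (by simp)
  refine (blockLang_append_tailWord_iff hτ (ht _) 0).2
    ⟨⟨ht, ?_, ?_, ?_, ?_, ?_, ?_⟩, ?_, ?_, ?_⟩
  · simp [blockHead, zOrder]
  · simp [blockHead]
  · simp [blockHead]
  · simp [blockHead, preCount]
  · simp [blockHead, preCount]
  · simp [blockHead, preCount]
  · rw [YCond, preCount_blockHead_append hP (by simp) (by simp)]
    simp [preCount]
  · rw [preCount_blockHead_append hP (by simp) (by simp)]
    simp
  · rw [preCount_blockHead_append hP (by simp) (by simp)]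
    simp [preCount]

theorem not_blockLang_interleavedWord {P τ : List ZIndex} (hP : (zOrder P).Nodup)
    (hτ : (ZIndex.b :: τ).Nodup) :
    ¬ BlockLang P (.b :: τ) (fun l => YCond l ∧ XCond l)
      (interleavedWord P τ [.x, .z .d, .z .c, .z .e, .y]) := by
  intro h
  have h₁ := ((blockLang_append_tailWord_iff hτ
    (not_t_mem_blockHead_append (by simp) _) 0).1 h).2.2.1
  rw [preCount_blockHead_append hP (by simp) (by simp)] at h₁
  simp [preCount] at h₁

theorem mainTheorem3 (k : ℕ) (hk : 1 ≤ k) (π : Equiv.Perm (Fin k)) :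
    ¬ IsDistributive (MonoidVariety.SubvarietyLattice (MonoidVariety.generatedBy
      (QuotMonoid (lambdaCon Letter) {(hatA k π : (lambdaCon Letter).Quotient)}))) := by
  obtain ⟨m, rfl⟩ := Nat.exists_eq_add_of_le' hk
  intro hdist
  have hP := nodup_zOrder π
  have hτ := nodup_hatTailOrder π
  have hPτ : ∀ q ∈ zOrder (hatOrder π), q ∈ ZIndex.b :: hatTailOrder π :=
    fun q => (mem_zOrder_iff π q).1
  set V := MonoidVariety.generatedBy
      (QuotMonoid (lambdaCon Letter) {(hatA (m + 1) π : (lambdaCon Letter).Quotient)}) with hV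
  let W : List Var → List Var := interleavedWord (hatOrder π) (hatTailOrder π)
  let mm := W [.z .d, .x, .z .c, .z .e, .y]
  let lm := W [.x, .z .d, .z .c, .z .e, .y]
  let ml := W [.z .d, .x, .z .c, .y, .z .e]
  let I (u v : List Var) : MonoidVariety :=
    MonoidVariety.ofIdentity (FreeMonoid.ofList u) (FreeMonoid.ofList v)
  let L (C : List Var → Prop) : List Var → Prop := BlockLang (hatOrder π) (.b :: hatTailOrder π) C
  have hY : (V ⊓ I mm lm).Mem (syntacticCon (L YCond)).Quotient :=
    MonoidVariety.mem_inf (syntacticCon_mem_generatedBy fun u v h h' => h.blockLang_yCond h')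
      (syntacticCon_mem_ofIdentity fun φ p s => blockLang_yCond hP hτ hPτ φ p s)
  have hX : (V ⊓ I mm ml).Mem (syntacticCon (L XCond)).Quotient :=
    MonoidVariety.mem_inf (syntacticCon_mem_generatedBy fun u v h h' => h.blockLang_xCond h')
      (syntacticCon_mem_ofIdentity fun φ p s => blockLang_xCond hP hτ hPτ φ p s)
  let A : Set.Iic V := ⟨V ⊓ I mm lm, Set.mem_Iic.2 inf_le_left⟩
  let B : Set.Iic V := ⟨V ⊓ I mm ml, Set.mem_Iic.2 inf_le_left⟩
  let C : Set.Iic V := ⟨V ⊓ I lm ml, Set.mem_Iic.2 inf_le_left⟩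
  let L₀ : List Var → Prop := fun w => L YCond w ∧ L XCond w
  have hL₀ : ∀ w, L₀ w ↔ L (fun l => YCond l ∧ XCond l) w := fun w => blockLang_and_iff hτ
  have hAB : (A ⊔ B).1.Mem (syntacticCon L₀).Quotient :=
    syntacticCon_and_mem ((le_sup_left : A ≤ A ⊔ B) _ hY) ((le_sup_right : B ≤ A ⊔ B) _ hX)
  have hC : C.1.Mem (syntacticCon L₀).Quotient := by
    refine MonoidVariety.mem_inf ((A ⊔ B).2 _ hAB) (syntacticCon_mem_ofIdentity fun φ p s => ?_)
    rw [hL₀, hL₀]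
    exact blockLang_and hP hτ hPτ φ p s
  have hABC : ((A ⊔ B) ⊓ C).1.Mem (syntacticCon L₀).Quotient := MonoidVariety.mem_inf hAB hC
  rw [hdist A B C] at hABC
  -- A ∧ C satisfies the identity through `A`; B ∧ C satisfies it by transitivity through `ml`.
  have hle : ((A ⊓ C) ⊔ (B ⊓ C)).1 ≤ I mm lm := by
    refine sup_le (inf_le_left.trans inf_le_right) fun M _ hM f => ?_
    have h₁ : (I mm ml).Mem M := (inf_le_left.trans inf_le_right : B.1 ⊓ C.1 ≤ I mm ml) M hM
    have h₂ : (I lm ml).Mem M := (inf_le_right.trans inf_le_right : B.1 ⊓ C.1 ≤ I lm ml) M hM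
    exact (h₁ f).trans (h₂ f).symm
  have hN : L₀ ([] ++ mm ++ []) ↔ L₀ ([] ++ lm ++ []) :=
    (Con.eq _).1 (hle _ hABC (Con.mk' _)) [] []
  rw [List.nil_append, List.nil_append, List.append_nil, List.append_nil, hL₀, hL₀] at hN
  exact not_blockLang_interleavedWord hP hτ (hN.1 (blockLang_interleavedWord hP hτ))
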